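/- For $0<\nu<1$ let $m=\frac{3}{16}(1-\nu)$ and let $r=r(\cdot,\nu)$ be the unique even positive solution of $-m r''+m r-r^3+r^5=0$ on $\mathbb{R}$ which vanishes at infinity. Let $A=A(\nu)$ be the unbounded operator in $L^2(\mathbb{R};\mathbb{C})$ with domain $D(A)=H^2(\mathbb{R})$ given by $$A u=-m u''+(m-3r^2+5r^4)u .$$ Theorem 2.7. There exist a constant $K>0$ and $\nu_0\in(0,1)$ such that, for all $\nu\in(0,\nu_0)$, the spectrum $\operatorname{sp}(A)$ is contained in $[-K,K]\cup[2K,+\infty)$; moreover $\lambda=\min \operatorname{sp}(A)$ exists and is strictly negative, $\operatorname{sp}(A)\cap[-K,K]=\{\lambda,0\}$, and $\lambda$ and $0$ are simple eigenvalues of $A$ (each has a one-dimensional eigenspace). -/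

import Mathlib

open MeasureTheory Set Filter Topology
open scoped ENNReal SchwartzMap

namespace PulseLinearization

noncomputable section

/-- The complex Hilbert space `L²(ℝ)`. -/
abbrev L2 : Type := Lp ℂ 2 (volume : Measure ℝ)

/-! ### The pulse -/

/-- The coefficient `m = (3/16)(1 - ν)`, that is `ν = 1 - 16 m / 3`. -/
def mass (ν : ℝ) : ℝ := 3 / 16 * (1 - ν)

/-- `r` is the even positive solution of `-m r'' + m r - r³ + r⁵ = 0` which vanishes at infinity,
for `m = (3/16)(1 - ν)`. -/
structure IsPulse (ν : ℝ) (r : ℝ → ℝ) : Prop where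
  contDiff : ContDiff ℝ 2 r
  ode : ∀ x, -mass ν * deriv (deriv r) x + mass ν * r x - r x ^ 3 + r x ^ 5 = 0
  even : ∀ x, r (-x) = r x
  pos : ∀ x, 0 < r x
  tendsto_zero : Tendsto r (cocompact ℝ) (𝓝 0)

/-- The potential `V = m - 3 r² + 5 r⁴`. -/
def potential (ν : ℝ) (r : ℝ → ℝ) (x : ℝ) : ℝ := mass ν - 3 * r x ^ 2 + 5 * r x ^ 4

theorem IsPulse.potential_memLp {ν : ℝ} {r : ℝ → ℝ} (hr : IsPulse ν r) :
    MemLp (fun x => (potential ν r x : ℂ)) ∞ (volume : Measure ℝ) := by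
  have hc : Continuous r := hr.contDiff.continuous
  let f : ZeroAtInftyContinuousMap ℝ ℝ := ⟨⟨r, hc⟩, hr.tendsto_zero⟩
  have hb : ∀ x, |r x| ≤ ‖f.toBCF‖ := fun x => f.toBCF.norm_coe_le_norm x
  refine memLp_top_of_bound (C := |mass ν| + 3 * ‖f.toBCF‖ ^ 2 + 5 * ‖f.toBCF‖ ^ 4) ?_ ?_
  · refine Continuous.aestronglyMeasurable ?_
    unfold potential
    fun_prop
  · refine Eventually.of_forall fun x => ?_
    have h2 : |r x| ^ 2 ≤ ‖f.toBCF‖ ^ 2 := pow_le_pow_left₀ (abs_nonneg _) (hb x) 2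
    have h4 : |r x| ^ 4 ≤ ‖f.toBCF‖ ^ 4 := pow_le_pow_left₀ (abs_nonneg _) (hb x) 4
    rw [Complex.norm_real, Real.norm_eq_abs, potential]
    calc |mass ν - 3 * r x ^ 2 + 5 * r x ^ 4|
        ≤ |mass ν - 3 * r x ^ 2| + |5 * r x ^ 4| := abs_add_le _ _
      _ ≤ |mass ν| + |3 * r x ^ 2| + |5 * r x ^ 4| := by gcongr; exact abs_sub _ _
      _ = |mass ν| + 3 * |r x| ^ 2 + 5 * |r x| ^ 4 := by simp [abs_mul, abs_pow]
      _ ≤ _ := by gcongr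

/-! ### The Sobolev space `H²(ℝ)` and the second derivative -/

/-- The Sobolev space `H²(ℝ)` as a subspace of `L²(ℝ)`. -/
def H2 : Submodule ℂ L2 where
  carrier := {u | TemperedDistribution.MemSobolev 2 2 (u : 𝓢'(ℝ, ℂ))}
  add_mem' {u v} hu hv := by
    simpa only [← Lp.toTemperedDistributionCLM_apply, map_add, mem_ofPred_eq] using
      TemperedDistribution.MemSobolev.add hu hv
  zero_mem' := by
    simpa only [← Lp.toTemperedDistributionCLM_apply, map_zero, mem_ofPred_eq] using
      TemperedDistribution.memSobolev_fun_zero ℝ ℂ 2 2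
  smul_mem' c u hu := by
    simpa only [← Lp.toTemperedDistributionCLM_apply, map_smul, mem_ofPred_eq] using
      TemperedDistribution.MemSobolev.smul c hu

/-- The second distributional derivative `u''` of `u ∈ L²(ℝ)`. -/
def distribDeriv2 (u : L2) : 𝓢'(ℝ, ℂ) :=
  TemperedDistribution.derivCLM ℂ (TemperedDistribution.derivCLM ℂ (u : 𝓢'(ℝ, ℂ)))

theorem toTemperedDistribution_injective {u v : L2} (h : (u : 𝓢'(ℝ, ℂ)) = (v : 𝓢'(ℝ, ℂ))) :
    u = v := by
  have hk := Lp.ker_toTemperedDistributionCLM_eq_bot (F := ℂ) (μ := (volume : Measure ℝ)) (p := 2)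
  exact LinearMap.ker_eq_bot.mp hk h

open scoped LineDeriv in
theorem exists_secondDeriv {u : L2} (hu : u ∈ H2) : ∃ w : L2, (w : 𝓢'(ℝ, ℂ)) = distribDeriv2 u := by
  have key : ∀ T : 𝓢'(ℝ, ℂ), TemperedDistribution.derivCLM ℂ T = ∂_{(1 : ℝ)} T := by
    intro T
    ext g
    rw [TemperedDistribution.derivCLM_apply_apply, TemperedDistribution.lineDerivOp_apply_apply]
    congr 2
  have hu' : TemperedDistribution.MemSobolev 2 2 (u : 𝓢'(ℝ, ℂ)) := hu
  have h2 := (hu'.lineDerivOp (m := (1 : ℝ))).lineDerivOp (m := (1 : ℝ))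
  norm_num at h2
  obtain ⟨w, hw⟩ := TemperedDistribution.memSobolev_zero_iff.mp h2
  exact ⟨w, by rw [distribDeriv2, key, key, hw]⟩

/-- The second derivative as a linear map `H²(ℝ) → L²(ℝ)`: `secondDeriv u` is the `L²` function
which represents the distribution `u''`. -/
def secondDeriv : H2 →ₗ[ℂ] L2 where
  toFun u := (exists_secondDeriv u.2).choose
  map_add' u v := by
    refine toTemperedDistribution_injective ?_
    rw [(exists_secondDeriv (u + v).2).choose_spec, ← Lp.toTemperedDistributionCLM_apply, map_add]
    simp only [Lp.toTemperedDistributionCLM_apply]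
    rw [(exists_secondDeriv u.2).choose_spec, (exists_secondDeriv v.2).choose_spec]
    simp only [distribDeriv2, ← Lp.toTemperedDistributionCLM_apply, Submodule.coe_add, map_add]
  map_smul' c u := by
    refine toTemperedDistribution_injective ?_
    rw [(exists_secondDeriv (c • u).2).choose_spec, ← Lp.toTemperedDistributionCLM_apply, map_smul]
    simp only [Lp.toTemperedDistributionCLM_apply, RingHom.id_apply]
    rw [(exists_secondDeriv u.2).choose_spec]
    simp only [distribDeriv2, ← Lp.toTemperedDistributionCLM_apply, Submodule.coe_smul, map_smul]

theorem secondDeriv_spec (u : H2) : (secondDeriv u : 𝓢'(ℝ, ℂ)) = distribDeriv2 u :=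
  (exists_secondDeriv u.2).choose_spec

/-! ### Schrödinger operators and the linearized operator -/

/-- Multiplication by an essentially bounded function on `L²(ℝ)`. -/
def mulOp {V : ℝ → ℂ} (hV : MemLp V ∞ (volume : Measure ℝ)) : L2 →ₗ[ℂ] L2 where
  toFun u := ((hV.toLp V • u : L2))
  map_add' u v := Lp.add_smul _ u v
  map_smul' c u := (Lp.smul_comm c (hV.toLp V) u).symm

theorem mulOp_ae {V : ℝ → ℂ} (hV : MemLp V ∞ (volume : Measure ℝ)) (u : L2) :
    mulOp hV u =ᵐ[volume] fun x => V x * u x := by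
  filter_upwards [Lp.coeFn_lpSMul (r := 2) (hV.toLp V) u, hV.coeFn_toLp] with x h1 h2
  change ((hV.toLp V • u : L2) : ℝ → ℂ) x = _
  rw [h1, Pi.smul_apply', h2, smul_eq_mul]

/-- The linearized operator around the pulse `r`: the unbounded operator in `L²(ℝ)` with domain
`H²(ℝ)` given by `A u = -m u'' + V u`, `V = m - 3 r² + 5 r⁴`. -/
def linearized {ν : ℝ} {r : ℝ → ℝ} (hr : IsPulse ν r) : L2 →ₗ.[ℂ] L2 where
  domain := H2
  toFun := -(mass ν : ℂ) • secondDeriv + (mulOp hr.potential_memLp).comp H2.subtype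

/-! ### Spectrum of an unbounded operator -/

section Spectrum

variable {E : Type*} [NormedAddCommGroup E] [NormedSpace ℂ E]

/-- The resolvent set of an unbounded operator `T`: the `z` for which `z - T` is a bijection of the
domain of `T` onto `E` with bounded inverse. -/
def resolventSet (T : E →ₗ.[ℂ] E) : Set ℂ :=
  {z | ∃ R : E →L[ℂ] E,
    (∀ u : T.domain, R (z • (u : E) - T u) = u) ∧
    (∀ f : E, ∃ u : T.domain, (u : E) = R f ∧ z • (u : E) - T u = f)}

/-- The spectrum of an unbounded operator. -/
def spectrum (T : E →ₗ.[ℂ] E) : Set ℂ := (resolventSet T)ᶜ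

/-- The eigenspace `{u ∈ D(T) : T u = z u}`. -/
def eigenspace (T : E →ₗ.[ℂ] E) (z : ℂ) : Submodule ℂ E where
  carrier := {u | ∃ hu : u ∈ T.domain, T ⟨u, hu⟩ = z • u}
  add_mem' := by
    rintro u v ⟨hu, hu'⟩ ⟨hv, hv'⟩
    refine ⟨T.domain.add_mem hu hv, ?_⟩
    rw [smul_add, ← hu', ← hv', ← T.map_add]
    rfl
  zero_mem' := ⟨T.domain.zero_mem, by rw [smul_zero]; exact T.map_zero⟩
  smul_mem' := by
    rintro c u ⟨hu, hu'⟩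
    refine ⟨T.domain.smul_mem c hu, ?_⟩
    rw [smul_comm, ← hu', ← T.map_smul]
    rfl

end Spectrum

/-! ### Existence of the pulse -/

/-- The explicit profile `r = √R`, `R(x) = (3/4)(1 - ν) / (1 + √ν cosh 2x)`, is a pulse. -/
theorem exists_isPulse {ν : ℝ} (hν : ν ∈ Ioo (0 : ℝ) 1) : ∃ r, IsPulse ν r := by
  obtain ⟨hν0, hν1⟩ := hν
  set c := √ν with hc
  have hc0 : 0 < c := Real.sqrt_pos.mpr hν0
  have hcν : c ^ 2 = ν := Real.sq_sqrt hν0.le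
  set a := √(3 / 4 * (1 - ν)) with ha
  have ha0 : 0 < a := Real.sqrt_pos.mpr (by linarith)
  have haν : a ^ 2 = 3 / 4 * (1 - ν) := Real.sq_sqrt (by linarith)
  let D : ℝ → ℝ := fun x => 1 + c * Real.cosh (2 * x)
  have hD0 : ∀ x, 0 < D x := fun x => by
    have := Real.cosh_pos (2 * x)
    positivity
  let S : ℝ → ℝ := fun x => √(D x)
  have hS0 : ∀ x, 0 < S x := fun x => Real.sqrt_pos.mpr (hD0 x)
  have hSD : ∀ x, S x ^ 2 = D x := fun x => Real.sq_sqrt (hD0 x).le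
  have hSs : ContDiff ℝ 2 S := by
    refine ContDiff.sqrt ?_ fun x => (hD0 x).ne'
    exact contDiff_const.add (contDiff_const.mul
      (Real.contDiff_cosh.comp (contDiff_const.mul contDiff_id)))
  have hS' : ∀ x, HasDerivAt S (c * Real.sinh (2 * x) / S x) x := fun x => by
    have h1 : HasDerivAt (fun y : ℝ => 2 * y) 2 x := by
      simpa using (hasDerivAt_id x).const_mul (2 : ℝ)
    have h2 : HasDerivAt D (c * (Real.sinh (2 * x) * 2)) x :=
      (((Real.hasDerivAt_cosh (2 * x)).comp x h1).const_mul c).const_add 1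
    have h3 := h2.sqrt (hD0 x).ne'
    refine h3.congr_deriv ?_
    change c * (Real.sinh (2 * x) * 2) / (2 * S x) = _
    field_simp
  have hr' : ∀ x, HasDerivAt (fun y => a / S y) (-(a * c * Real.sinh (2 * x)) / S x ^ 3) x :=
    fun x => by
    have h := (hasDerivAt_const x a).div (hS' x) (hS0 x).ne'
    refine h.congr_deriv ?_
    have := (hS0 x).ne'
    field_simp
    ring
  have hr'' : ∀ x, HasDerivAt (fun y => -(a * c * Real.sinh (2 * y)) / S y ^ 3)
      (-(2 * a * c * Real.cosh (2 * x)) / S x ^ 3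
        + 3 * a * (c * Real.sinh (2 * x)) ^ 2 / S x ^ 5) x := fun x => by
    have h1 : HasDerivAt (fun y : ℝ => 2 * y) 2 x := by
      simpa using (hasDerivAt_id x).const_mul (2 : ℝ)
    have h2 : HasDerivAt (fun y => -(a * c * Real.sinh (2 * y)))
        (-(a * c * (Real.cosh (2 * x) * 2))) x :=
      (((Real.hasDerivAt_sinh (2 * x)).comp x h1).const_mul (a * c)).neg
    have h := h2.div ((hS' x).pow 3) (pow_ne_zero 3 (hS0 x).ne')
    refine h.congr_deriv ?_
    have := (hS0 x).ne'
    rw [Pi.pow_apply]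
    field_simp
    ring
  have hd1 : deriv (fun y => a / S y) = fun y => -(a * c * Real.sinh (2 * y)) / S y ^ 3 :=
    funext fun x => (hr' x).deriv
  refine ⟨fun x => a / S x, ?_, ?_, ?_, ?_, ?_⟩
  · exact contDiff_const.div hSs fun x => (hS0 x).ne'
  · intro x
    rw [hd1, (hr'' x).deriv]
    have hs := (hS0 x).ne'
    have hsh : Real.sinh (2 * x) ^ 2 = Real.cosh (2 * x) ^ 2 - 1 := Real.sinh_sq _
    have hch : c * Real.cosh (2 * x) = S x ^ 2 - 1 := by rw [hSD]; simp [D]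
    have hsh2 : (c * Real.sinh (2 * x)) ^ 2 = (S x ^ 2 - 1) ^ 2 - ν := by
      rw [mul_pow, hsh, ← hch, ← hcν]; ring
    have hch2 : 2 * a * c * Real.cosh (2 * x) = 2 * a * (S x ^ 2 - 1) := by rw [← hch]; ring
    rw [hsh2, hch2]
    have hm : mass ν = a ^ 2 / 4 := by rw [mass, haν]; ring
    have hν' : ν = 1 - 4 / 3 * a ^ 2 := by rw [haν]; ring
    rw [hm, hν']
    field_simp
    ring
  · intro x
    simp [S, D]
  · intro x
    exact div_pos ha0 (hS0 x)
  · have hcosh : Tendsto (fun x : ℝ => c * |x|) (cocompact ℝ) atTop :=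
      (tendsto_norm_cocompact_atTop (E := ℝ)).const_mul_atTop hc0
    have hDt : Tendsto D (cocompact ℝ) atTop := by
      refine tendsto_atTop_mono (fun x => ?_) hcosh
      have h1 : |x| ≤ Real.cosh (2 * x) := by
        rw [← Real.cosh_abs]
        have h2 : |2 * x| + 1 ≤ Real.exp |2 * x| := Real.add_one_le_exp _
        have h3 : 0 ≤ Real.exp (-|2 * x|) := (Real.exp_pos _).le
        have h4 : |2 * x| = 2 * |x| := by simp [abs_mul]
        rw [Real.cosh_eq]
        linarith [abs_nonneg x]
      have := mul_le_mul_of_nonneg_left h1 hc0.le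
      change c * |x| ≤ 1 + c * Real.cosh (2 * x)
      linarith
    exact tendsto_const_nhds.div_atTop (Real.tendsto_sqrt_atTop.comp hDt)

end

end PulseLinearization

/-! The pulse is explicit: `r² = 4m/D` with `D = 1 + √ν cosh 2x` (`IsPulse.sq_eq`), so `A = m(-d² +
W)` with `W` the function `scaledPotential`. For small `ν` the pulse is a pair of widely separated
fronts, and the low spectrum comes from the two translation modes of these fronts. The odd
combination `sinh 2x / D^{3/2}` is a multiple of `r'` and satisfies `A r' = 0`. The even combination
`w = cosh 2x / D^{3/2}` is annihilated by `-d² + W + q`, where `q = 12 √ν / (D cosh 2x)` satisfies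
`0 < q ≤ 12 √ν`. Hence `⟨w, A w⟩ = -m ∫ q w² < 0`, so there is negative spectrum.

The main estimate is `⟨u, A u⟩ ≥ m dist(u, span)² - 12 √ν m ‖u‖²`, the distance being taken to the
span of the two modes (`form_ge_infDist_sq`). Splitting `u` by parity reduces it to half-line
inequalities for `-d² + W` and `-d² + W + q` (`oddMode_form_nonneg`, `evenMode_form_nonneg`). Each
potential has a positive solution on the half-line, so the operator factors, and its gap above that
solution is read off from the partner operator obtained by exchanging the factors
(`halfLine_form_nonneg`). Both partner operators are at least 1 with Dirichlet condition at 0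
(`oddMode_gap`, `evenMode_gap`).

Consequently the form is at least `-12 √ν m` everywhere and at least `(1 - 12 √ν) m` on the
orthogonal complement of the two modes. A dimension count in the style of min-max
(`IsPerturbedInverse.spectrum_of_form_bounds`) leaves room below `(1 - 12 √ν) m` for just the kernel
and one negative eigenvalue, both simple. No spectral theorem is needed: writing `A` on the range of
a bounded symmetric operator turns resolvent questions into questions on bounded operators
(`mem_resolventSet`). -/

namespace PulseLinearization

/-! ### Spectrum of a symmetric operator from bounds on its quadratic form -/

section AbstractSpectrum

variable {H : Type*} [NormedAddCommGroup H] [InnerProductSpace ℂ H]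

/-- `A = a R⁻¹ + V` on the range of `R`, for bounded symmetric operators `R`, `V` and a real number
`a ≠ 0`. -/
structure IsPerturbedInverse (A : H →ₗ.[ℂ] H) (R V : H →L[ℂ] H) (a : ℝ) : Prop where
  ne_zero : a ≠ 0
  symm_inv : ∀ f g, inner ℂ (R f) g = inner ℂ f (R g)
  symm_pert : ∀ f g, inner ℂ (V f) g = inner ℂ f (V g)
  mem_domain : ∀ h, R h ∈ A.domain
  map_eq : ∀ h, A ⟨R h, mem_domain h⟩ = (a : ℂ) • h + V (R h)
  exists_eq : ∀ u : A.domain, ∃ h, u = ⟨R h, mem_domain h⟩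

namespace IsPerturbedInverse

variable {A : H →ₗ.[ℂ] H} {R V : H →L[ℂ] H} {a : ℝ}

theorem symm (hA : IsPerturbedInverse A R V a) (u v : A.domain) :
    inner ℂ (A u) (v : H) = inner ℂ (u : H) (A v) := by
  obtain ⟨h, rfl⟩ := hA.exists_eq u
  obtain ⟨k, rfl⟩ := hA.exists_eq v
  rw [hA.map_eq, hA.map_eq, inner_add_left, inner_smul_left, Complex.conj_ofReal, hA.symm_pert,
    inner_add_right, inner_smul_right, ← hA.symm_inv h k]

theorem inner_map_self_im (hA : IsPerturbedInverse A R V a) (u : A.domain) :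
    (inner ℂ (u : H) (A u)).im = 0 := by
  have h := hA.symm u u
  rw [← inner_conj_symm] at h
  exact Complex.conj_eq_iff_im.mp h

theorem eq_zero_of_mem_resolventSet {z : ℂ} (hz : z ∈ resolventSet A) (u : A.domain)
    (hu : A u = z • (u : H)) : (u : H) = 0 := by
  obtain ⟨T, hT, -⟩ := hz
  have := hT u
  rw [hu, sub_self, map_zero] at this
  exact this.symm

variable [CompleteSpace H]

/-- A point is in the resolvent set if the operator is bounded below there on a subspace of finite
codimension and neither the point nor its conjugate is an eigenvalue. -/
theorem mem_resolventSet (hA : IsPerturbedInverse A R V a) {G : Type*} [NormedAddCommGroup G]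
    [NormedSpace ℂ G] [FiniteDimensional ℂ G] (ℓ : H →L[ℂ] G) {z : ℂ} {δ : ℝ} (hδ : 0 < δ)
    (hbound : ∀ u : A.domain, ℓ u = 0 → δ * ‖(u : H)‖ ≤ ‖z • (u : H) - A u‖)
    (hz : ∀ u : A.domain, A u = z • (u : H) → (u : H) = 0)
    (hz' : ∀ u : A.domain, A u = (starRingEnd ℂ z) • (u : H) → (u : H) = 0) :
    z ∈ resolventSet A := by
  have ha : (a : ℂ) ≠ 0 := by exact_mod_cast hA.ne_zero
  -- `S` is the bounded operator `(z - A) R`; inverting `S` gives the resolvent as `R S⁻¹`.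
  set S : H →L[ℂ] H := z • R - (a : ℂ) • ContinuousLinearMap.id ℂ H - V.comp R with hS
  have hSA : ∀ h, S h = z • R h - A ⟨R h, hA.mem_domain h⟩ := fun h => by
    rw [hA.map_eq]; simp [hS, sub_sub]
  have hker : ∀ h, S h = 0 → h = 0 := fun h hh => by
    rw [hSA, sub_eq_zero] at hh
    have h0 : R h = 0 := hz ⟨R h, hA.mem_domain h⟩ hh.symm
    have h1 := hA.map_eq h
    rw [← hh, h0] at h1
    simpa [hA.ne_zero] using h1.symm
  -- On the finite-codimensional subspace where `ℓ ∘ R` vanishes, `S` is bounded below, so its image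
  -- there is closed; the finitely many remaining dimensions preserve closedness. The bound on `h`
  -- itself, rather than on `R h`, comes from solving `S h = z R h - a h - V R h` for `a h`.
  have hclosed : IsClosed (S.range : Set H) := by
    let s : Submodule ℂ H := (ℓ.comp R).ker
    have : s.CoFG := Submodule.CoFG.ker _
    have hs : IsClosed (s : Set H) := (ℓ.comp R).isClosed_ker
    have : CompleteSpace s := hs.completeSpace_coe
    refine LinearMap.isClosed_range_of_isClosed_map_of_finiteDimensional_quotient (s := s) ?_
    obtain ⟨M, hM⟩ : ∃ M : ℝ, 0 ≤ M ∧ ∀ h ∈ s, ‖h‖ ≤ M * ‖S h‖ := by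
      refine ⟨|a|⁻¹ * (1 + (‖z‖ + ‖V‖) * δ⁻¹), by positivity, fun h hh => ?_⟩
      have h1 : δ * ‖R h‖ ≤ ‖S h‖ := by
        rw [hSA]; exact hbound ⟨R h, hA.mem_domain h⟩ hh
      have h2 : (a : ℂ) • h = z • R h - V (R h) - S h := by simp [hS]
      have h3 : |a| * ‖h‖ ≤ ‖S h‖ + (‖z‖ + ‖V‖) * ‖R h‖ := by
        calc |a| * ‖h‖ = ‖(a : ℂ) • h‖ := by simp [norm_smul]
          _ ≤ ‖z • R h‖ + ‖V (R h)‖ + ‖S h‖ := by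
            rw [h2]; exact (norm_sub_le _ _).trans (by gcongr; exact norm_sub_le _ _)
          _ ≤ ‖z‖ * ‖R h‖ + ‖V‖ * ‖R h‖ + ‖S h‖ := by
            rw [norm_smul]; gcongr; exact V.le_opNorm _
          _ = _ := by ring
      have h4 : ‖R h‖ ≤ δ⁻¹ * ‖S h‖ := by
        rw [inv_mul_eq_div, le_div_iff₀ hδ]; linarith
      have ha' : 0 < |a| := abs_pos.mpr hA.ne_zero
      rw [mul_assoc, inv_mul_eq_div, le_div_iff₀ ha']
      have h5 : (‖z‖ + ‖V‖) * ‖R h‖ ≤ (‖z‖ + ‖V‖) * (δ⁻¹ * ‖S h‖) := by gcongr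
      linarith
    have hanti : AntilipschitzWith ⟨M, hM.1⟩ (S.comp s.subtypeL) :=
      ContinuousLinearMap.antilipschitz_of_bound _ fun h => hM.2 h h.2
    have := hanti.isClosed_range (S.comp s.subtypeL).uniformContinuous
    convert this using 1
    ext y
    simp
  have hrange : S.range = ⊤ := by
    have : CompleteSpace S.range := hclosed.completeSpace_coe
    rw [← Submodule.orthogonal_eq_bot_iff, Submodule.eq_bot_iff]
    intro f hf
    -- This is the adjoint equation `S* f = 0`. As `a ≠ 0` it exhibits `f` as `R k`, so `f` lies in
    -- the domain and is an eigenvector for the conjugate of `z`, which `hz'` excludes.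
    have h1 : (starRingEnd ℂ z) • R f - (a : ℂ) • f - R (V f) = 0 := by
      refine ext_inner_right ℂ fun h => ?_
      have h2 : inner ℂ (S h) f = 0 := hf (S h) ⟨h, rfl⟩
      rw [← inner_conj_symm, map_eq_zero] at h2
      rw [inner_zero_left, ← h2]
      simp only [hS, sub_apply, smul_apply,
        ContinuousLinearMap.id_apply, ContinuousLinearMap.comp_apply,
        inner_sub_left, inner_sub_right, inner_smul_left, inner_smul_right, hA.symm_pert,
        hA.symm_inv, Complex.conj_ofReal, Complex.conj_conj]
    set k : H := (a : ℂ)⁻¹ • ((starRingEnd ℂ z) • f - V f) with hk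
    have hRk : R k = f := by
      have : (a : ℂ) • f = (starRingEnd ℂ z) • R f - R (V f) := by
        rw [sub_right_comm, sub_eq_zero] at h1; exact h1.symm
      rw [hk, map_smul, map_sub, map_smul, ← this, inv_smul_smul₀ ha]
    have h2 := hz' ⟨R k, hA.mem_domain k⟩ (by
      rw [hA.map_eq]
      simp only [hRk]
      rw [hk, smul_inv_smul₀ ha]
      abel)
    simpa [hRk] using h2
  have hker' : S.ker = ⊥ := by
    rw [Submodule.eq_bot_iff]
    exact fun h hh => hker h hh
  let e := ContinuousLinearEquiv.ofBijective S hker' hrange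
  have he : ∀ h, e h = S h := fun h => rfl
  refine ⟨R.comp (e.symm : H →L[ℂ] H), fun u => ?_, fun f => ?_⟩
  · obtain ⟨h, rfl⟩ := hA.exists_eq u
    rw [← hSA, ← he]
    simp
  · refine ⟨⟨R (e.symm f), hA.mem_domain _⟩, rfl, ?_⟩
    rw [← hSA, ← he]
    simp

/-- The spectrum of a self-adjoint operator whose form is bounded below by `κ` on the orthogonal
complement of two vectors, one of which spans part of the kernel, and which takes a negative
value. -/
theorem spectrum_of_form_bounds (hA : IsPerturbedInverse A R V a) {κ η : ℝ} (hκ : 0 < κ)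
    (hη : ∀ u : A.domain, -η * ‖(u : H)‖ ^ 2 ≤ (inner ℂ (u : H) (A u)).re)
    {e₀ : A.domain} (he₀ : (e₀ : H) ≠ 0) (hAe₀ : A e₀ = 0) (e₁ : H)
    (hκ' : ∀ u : A.domain, inner ℂ (e₀ : H) (u : H) = 0 → inner ℂ e₁ (u : H) = 0 →
      κ * ‖(u : H)‖ ^ 2 ≤ (inner ℂ (u : H) (A u)).re)
    {w : A.domain} (hw : (inner ℂ (w : H) (A w)).re < 0) :
    ∃ lam : ℝ, lam < 0 ∧ -η ≤ lam ∧ (lam : ℂ) ∈ spectrum A ∧ (0 : ℂ) ∈ spectrum A ∧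
      (∀ z ∈ spectrum A, ∃ x : ℝ, z = x ∧ (x = lam ∨ x = 0 ∨ κ ≤ x)) ∧
      Module.finrank ℂ (eigenspace A (lam : ℂ)) = 1 ∧ Module.finrank ℂ (eigenspace A 0) = 1 := by
  -- eigenvalues below `κ`
  have heig : ∀ z : ℂ, (∀ x : ℝ, z = x → x < κ) → z ∈ spectrum A →
      ∃ x : ℝ, z = x ∧ ∃ u : A.domain, (u : H) ≠ 0 ∧ A u = z • (u : H) := by
    intro z hzκ hz
    have hform : ∀ u : A.domain, inner ℂ (u : H) (z • (u : H) - A u) =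
        z * (‖(u : H)‖ : ℂ) ^ 2 - (inner ℂ (u : H) (A u)).re := fun u => by
      rw [inner_sub_right, inner_smul_right, inner_self_eq_norm_sq_to_K]
      congr 1
      apply Complex.ext <;> simp [hA.inner_map_self_im u]
    by_cases him : z.im = 0
    · have hzre : z = (z.re : ℂ) := Complex.ext rfl (by simp [him])
      refine ⟨z.re, hzre, ?_⟩
      by_contra hcon
      push Not at hcon
      have h0 : ∀ u : A.domain, A u = z • (u : H) → (u : H) = 0 := fun u hu => by
        by_contra hne
        exact hcon u hne hu
      -- Orthogonality to `e₀` and `e₁` is the finite-codimensional condition; there the form of `A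
      -- - z` is at least `κ - z.re`.
      refine hz (hA.mem_resolventSet (G := ℂ × ℂ)
        ((innerSL ℂ (e₀ : H)).prod (innerSL ℂ e₁)) (sub_pos.mpr (hzκ _ hzre)) ?_ h0 ?_)
      · intro u hu
        have hu1 : inner ℂ (e₀ : H) (u : H) = 0 := congrArg Prod.fst hu
        have hu2 : inner ℂ e₁ (u : H) = 0 := congrArg Prod.snd hu
        have h1 := hκ' u hu1 hu2
        have h2 : (κ - z.re) * ‖(u : H)‖ ^ 2 ≤ ‖(u : H)‖ * ‖z • (u : H) - A u‖ := by
          refine le_trans ?_ (norm_inner_le_norm (𝕜 := ℂ) _ _)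
          refine le_trans ?_ (Complex.abs_re_le_norm _)
          refine le_trans ?_ (neg_le_abs _)
          rw [hform, Complex.sub_re, Complex.ofReal_re, ← Complex.ofReal_pow,
            Complex.re_mul_ofReal]
          linarith
        rcases (norm_nonneg (u : H)).eq_or_lt with h | h
        · rw [← h]; simp
        · nlinarith
      · rwa [Complex.conj_eq_iff_im.mpr him]
    · exfalso
      -- Off the real axis symmetry bounds `z - A` below by `|Im z|` on the whole domain, so no
      -- condition `ℓ` is needed.
      have key : ∀ u : A.domain, |z.im| * ‖(u : H)‖ ≤ ‖z • (u : H) - A u‖ := fun u => by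
        have h2 : |z.im| * ‖(u : H)‖ ^ 2 ≤ ‖(u : H)‖ * ‖z • (u : H) - A u‖ := by
          refine le_trans ?_ (norm_inner_le_norm (𝕜 := ℂ) _ _)
          refine le_trans ?_ (Complex.abs_im_le_norm _)
          rw [hform, Complex.sub_im, Complex.ofReal_im, sub_zero, ← Complex.ofReal_pow,
            Complex.im_mul_ofReal, abs_mul, abs_of_nonneg (sq_nonneg ‖(u : H)‖)]
        rcases (norm_nonneg (u : H)).eq_or_lt with h | h
        · rw [← h]; simp
        · nlinarith
      have hpos : 0 < |z.im| := abs_pos.mpr him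
      refine hz (hA.mem_resolventSet (G := ℂ) 0 hpos (fun u _ => key u) (fun u hu => ?_)
        fun u hu => ?_)
      · have := key u
        rw [hu, sub_self, norm_zero] at this
        exact norm_le_zero_iff.mp (nonpos_of_mul_nonpos_right this hpos)
      · have h1 := hA.inner_map_self_im u
        rw [hu, inner_smul_right, inner_self_eq_norm_sq_to_K] at h1
        have h2 : z.im * ‖(u : H)‖ ^ 2 = 0 := by
          simpa [← Complex.ofReal_pow, Complex.im_mul_ofReal] using h1
        simpa [him] using h2
  -- orthogonality of eigenvectors
  have horth : ∀ (x y : ℝ) (u v : A.domain), A u = (x : ℂ) • (u : H) → A v = (y : ℂ) • (v : H) →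
      x ≠ y → inner ℂ (u : H) (v : H) = 0 := by
    intro x y u v hu hv hxy
    have h := hA.symm u v
    rw [hu, hv, inner_smul_left, inner_smul_right, Complex.conj_ofReal, ← sub_eq_zero,
      ← sub_mul] at h
    refine (mul_eq_zero.mp h).resolve_left ?_
    exact sub_ne_zero.mpr (by exact_mod_cast hxy)
  -- the bottom of the spectrum
  let Q : Set ℝ := {t | ∃ u : A.domain, ‖(u : H)‖ = 1 ∧ (inner ℂ (u : H) (A u)).re = t}
  have hQb : ∀ t ∈ Q, -η ≤ t := by
    rintro t ⟨u, hu, rfl⟩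
    simpa [hu] using hη u
  have hscale : ∀ (c : ℝ) (u : A.domain), (inner ℂ (((c : ℂ) • u : A.domain) : H)
      (A ((c : ℂ) • u))).re = c ^ 2 * (inner ℂ (u : H) (A u)).re := fun c u => by
    rw [A.map_smul, Submodule.coe_smul, inner_smul_left, inner_smul_right, Complex.conj_ofReal,
      ← mul_assoc, ← Complex.ofReal_mul, Complex.re_ofReal_mul, sq]
  have hQmem : ∀ u : A.domain, (u : H) ≠ 0 →
      (inner ℂ (u : H) (A u)).re / ‖(u : H)‖ ^ 2 ∈ Q := fun u hu => by
    have hn : ‖(u : H)‖ ≠ 0 := norm_ne_zero_iff.mpr hu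
    refine ⟨((‖(u : H)‖⁻¹ : ℝ) : ℂ) • u, ?_, ?_⟩
    · rw [Submodule.coe_smul, norm_smul, Complex.norm_real, norm_inv, norm_norm,
        inv_mul_cancel₀ hn]
    · rw [hscale, inv_pow, inv_mul_eq_div]
  have hw0 : (w : H) ≠ 0 := by
    intro h
    rw [h, inner_zero_left] at hw
    simp at hw
  have hQne : Q.Nonempty := ⟨_, hQmem w hw0⟩
  have hQbdd : BddBelow Q := ⟨-η, hQb⟩
  set lam := sInf Q with hlam
  have hlam0 : lam < 0 := (csInf_le hQbdd (hQmem w hw0)).trans_lt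
    (div_neg_of_neg_of_pos hw (by positivity))
  have hlamη : -η ≤ lam := le_csInf hQne hQb
  have hge : ∀ u : A.domain, lam * ‖(u : H)‖ ^ 2 ≤ (inner ℂ (u : H) (A u)).re := fun u => by
    by_cases hu : (u : H) = 0
    · simp [hu]
    · have h1 : lam ≤ _ := csInf_le hQbdd (hQmem u hu)
      rwa [le_div_iff₀ (by positivity)] at h1
  have hlamspec : (lam : ℂ) ∈ spectrum A := by
    rintro ⟨T, hT1, hT2⟩
    -- the form of `A - lam` is bounded below by `1 / ‖T‖`
    obtain ⟨s, hs, hsT⟩ : ∃ s : ℝ, 0 < s ∧ s * ‖T‖ ≤ 1 :=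
      ⟨(1 + ‖T‖)⁻¹, by positivity, by
        rw [inv_mul_eq_div, div_le_one (by positivity)]; linarith⟩
    have hbetter : ∀ u : A.domain, s * ‖(u : H)‖ ^ 2 ≤
        (inner ℂ (u : H) (A u)).re - lam * ‖(u : H)‖ ^ 2 := by
      intro u
      obtain ⟨v, -, hv⟩ := hT2 u
      have hTv : ‖(v : H)‖ ≤ ‖T‖ * ‖(u : H)‖ := by
        have := hT1 v
        rw [hv] at this
        rw [← this]
        exact T.le_opNorm _
      have hAv : A v = (lam : ℂ) • (v : H) - u := by rw [← hv]; abel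
      -- With `v = (lam - A)⁻¹ u`, the form of `A - lam` at `u + s v` equals its value at `u`, minus
      -- `2s‖u‖²`, minus `s² Re⟨v, u⟩`. It is nonnegative, and `s‖T‖ ≤ 1` absorbs the last term.
      -- This improves the lower bound by `s`, contradicting that `lam` is the infimum.
      have h1 := hge (u + (s : ℂ) • v)
      have h2 : inner ℂ (v : H) (A u) = (lam : ℂ) * inner ℂ (v : H) (u : H) -
          (‖(u : H)‖ : ℂ) ^ 2 := by
        rw [← hA.symm, hAv, inner_sub_left, inner_smul_left, Complex.conj_ofReal,
          inner_self_eq_norm_sq_to_K]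
        rfl
      have h3 : (inner ℂ ((u + (s : ℂ) • v : A.domain) : H) (A (u + (s : ℂ) • v))).re -
          lam * ‖((u + (s : ℂ) • v : A.domain) : H)‖ ^ 2 =
          (inner ℂ (u : H) (A u)).re - lam * ‖(u : H)‖ ^ 2 - 2 * s * ‖(u : H)‖ ^ 2
            - s ^ 2 * (inner ℂ (v : H) (u : H)).re := by
        have h5 : inner ℂ (u : H) (A v) = (lam : ℂ) * inner ℂ (u : H) (v : H) -
            (‖(u : H)‖ : ℂ) ^ 2 := by
          rw [hAv, inner_sub_right, inner_smul_right, inner_self_eq_norm_sq_to_K]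
          rfl
        have h6 : inner ℂ (v : H) (A v) = (lam : ℂ) * (‖(v : H)‖ : ℂ) ^ 2 -
            inner ℂ (v : H) (u : H) := by
          rw [hAv, inner_sub_right, inner_smul_right, inner_self_eq_norm_sq_to_K]
          rfl
        have h7 : (inner ℂ (u : H) (v : H)).re = (inner ℂ (v : H) (u : H)).re := by
          rw [← inner_conj_symm, Complex.conj_re]
        have h8 : ‖((u + (s : ℂ) • v : A.domain) : H)‖ ^ 2 = ‖(u : H)‖ ^ 2 +
            2 * s * (inner ℂ (v : H) (u : H)).re + s ^ 2 * ‖(v : H)‖ ^ 2 := by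
          rw [Submodule.coe_add, Submodule.coe_smul, norm_add_sq (𝕜 := ℂ), inner_smul_right,
            norm_smul, Complex.norm_real, Real.norm_of_nonneg hs.le, RCLike.re_to_complex,
            Complex.re_ofReal_mul, h7]
          ring
        rw [h8, A.map_add, A.map_smul, Submodule.coe_add, Submodule.coe_smul]
        simp only [inner_add_left, inner_add_right, inner_smul_left, inner_smul_right,
          Complex.conj_ofReal, h2, h5, h6, ← Complex.ofReal_pow, Complex.add_re, Complex.sub_re,
          Complex.re_ofReal_mul, Complex.ofReal_re, h7]
        ring
      have h4 : -(inner ℂ (v : H) (u : H)).re ≤ ‖T‖ * ‖(u : H)‖ ^ 2 := by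
        have := (abs_le.mp ((Complex.abs_re_le_norm _).trans
          (norm_inner_le_norm (𝕜 := ℂ) (v : H) (u : H)))).1
        nlinarith [norm_nonneg (u : H)]
      have h5 : s ^ 2 * -(inner ℂ (v : H) (u : H)).re ≤ s ^ 2 * (‖T‖ * ‖(u : H)‖ ^ 2) := by
        gcongr
      have h6 : s * (s * ‖T‖) * ‖(u : H)‖ ^ 2 ≤ s * 1 * ‖(u : H)‖ ^ 2 := by gcongr
      nlinarith
    have : lam + s ≤ lam := le_csInf hQne (by
      rintro t ⟨u, hu, rfl⟩
      have := hbetter u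
      rw [hu] at this
      linarith)
    linarith
  obtain ⟨-, -, ψ, hψ0, hψ⟩ := heig lam (fun x hx => by
    have : lam = x := by exact_mod_cast hx
    linarith) hlamspec
  have hψe : inner ℂ (e₀ : H) (ψ : H) = 0 :=
    horth 0 lam e₀ ψ (by simp [hAe₀]) hψ hlam0.ne'
  have hform_eig : ∀ (x : ℝ) (u : A.domain), A u = (x : ℂ) • (u : H) →
      (inner ℂ (u : H) (A u)).re = x * ‖(u : H)‖ ^ 2 := fun x u hu => by
    rw [hu, inner_smul_right, inner_self_eq_norm_sq_to_K, Complex.re_ofReal_mul]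
    norm_cast
  have hψ1 : inner ℂ e₁ (ψ : H) ≠ 0 := by
    intro h
    have h1 := hκ' ψ hψe h
    rw [hform_eig lam ψ hψ] at h1
    have : 0 < ‖(ψ : H)‖ ^ 2 := by positivity
    nlinarith
  -- no further eigenvectors below `κ`
  have hunique : ∀ (x : ℝ) (u : A.domain), x < κ → A u = (x : ℂ) • (u : H) →
      inner ℂ (e₀ : H) (u : H) = 0 → inner ℂ (ψ : H) (u : H) = 0 → (u : H) = 0 := by
    intro x u hx hu hue huψ
    -- `u - b ψ` is orthogonal to both `e₀` and `e₁`, while its form is `x‖u‖² + lam‖bψ‖²`. Since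
    -- `x` and `lam` are below `κ`, the lower bound `κ` forces `u = 0`.
    set b : ℂ := inner ℂ e₁ (u : H) / inner ℂ e₁ (ψ : H) with hb
    have h1 := hκ' (u - b • ψ)
      (by rw [Submodule.coe_sub, Submodule.coe_smul, inner_sub_right, inner_smul_right, hue, hψe]
          simp)
      (by rw [Submodule.coe_sub, Submodule.coe_smul, inner_sub_right, inner_smul_right, hb,
            div_mul_cancel₀ _ hψ1, sub_self])
    have huψ' : inner ℂ (u : H) (ψ : H) = 0 := by rw [← inner_conj_symm, huψ, map_zero]
    have h2 : ‖((u - b • ψ : A.domain) : H)‖ ^ 2 = ‖(u : H)‖ ^ 2 + ‖b‖ ^ 2 * ‖(ψ : H)‖ ^ 2 := by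
      rw [Submodule.coe_sub, Submodule.coe_smul, norm_sub_sq (𝕜 := ℂ), inner_smul_right, huψ',
        norm_smul]
      simp [mul_pow]
    have h3 : (inner ℂ ((u - b • ψ : A.domain) : H) (A (u - b • ψ))).re =
        x * ‖(u : H)‖ ^ 2 + lam * (‖b‖ ^ 2 * ‖(ψ : H)‖ ^ 2) := by
      have hψu : inner ℂ (u : H) (A ψ) = 0 := by rw [hψ, inner_smul_right, huψ', mul_zero]
      have huψ'' : inner ℂ (ψ : H) (A u) = 0 := by rw [hu, inner_smul_right, huψ, mul_zero]
      have hb2 : (starRingEnd ℂ) b * b = ((‖b‖ ^ 2 : ℝ) : ℂ) := by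
        rw [Complex.conj_mul', Complex.ofReal_pow]
      rw [← hform_eig x u hu, mul_left_comm, ← hform_eig lam ψ hψ, A.map_sub, A.map_smul,
        Submodule.coe_sub, Submodule.coe_smul]
      simp only [inner_sub_left, inner_sub_right, inner_smul_left, inner_smul_right, hψu, huψ'',
        mul_zero, sub_zero, zero_sub, mul_neg, sub_neg_eq_add]
      rw [← mul_assoc, mul_comm b, hb2, Complex.add_re, Complex.re_ofReal_mul]
    rw [h2, h3] at h1
    have h4 : 0 ≤ ‖b‖ ^ 2 * ‖(ψ : H)‖ ^ 2 := by positivity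
    have h5 : (κ - x) * ‖(u : H)‖ ^ 2 ≤ 0 := by nlinarith
    have h6 : ‖(u : H)‖ ^ 2 ≤ 0 := nonpos_of_mul_nonpos_right h5 (by linarith)
    have h7 : ‖(u : H)‖ = 0 := by nlinarith [norm_nonneg (u : H)]
    exact norm_eq_zero.mp h7
  have h0spec : (0 : ℂ) ∈ spectrum A := fun h =>
    he₀ (eq_zero_of_mem_resolventSet h e₀ (by simp [hAe₀]))
  refine ⟨lam, hlam0, hlamη, hlamspec, h0spec, fun z hz => ?_, ?_, ?_⟩
  · by_cases hzκ : ∀ x : ℝ, z = x → x < κ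
    · obtain ⟨x, rfl, u, hu0, hu⟩ := heig z hzκ hz
      refine ⟨x, rfl, ?_⟩
      by_contra! hcon
      exact hu0 (hunique x u hcon.2.2 hu
        (horth 0 x e₀ u (by simp [hAe₀]) hu hcon.2.1.symm) (horth lam x ψ u hψ hu hcon.1.symm))
    · push Not at hzκ
      obtain ⟨x, rfl, hx⟩ := hzκ
      exact ⟨x, rfl, Or.inr (Or.inr hx)⟩
  · have hmem : (ψ : H) ∈ eigenspace A (lam : ℂ) := ⟨ψ.2, hψ⟩
    rw [finrank_eq_one_iff_of_nonzero' (⟨ψ, hmem⟩ : eigenspace A (lam : ℂ))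
      fun h => hψ0 (congrArg Subtype.val h)]
    rintro ⟨u, hu, hAu⟩
    set b : ℂ := inner ℂ (ψ : H) u / inner ℂ (ψ : H) (ψ : H) with hb
    have hee : inner ℂ (ψ : H) (ψ : H) ≠ 0 := inner_self_ne_zero.mpr hψ0
    have hAd : A (⟨u, hu⟩ - b • ψ) = (lam : ℂ) • ((⟨u, hu⟩ - b • ψ : A.domain) : H) := by
      rw [A.map_sub, A.map_smul, hAu, hψ, Submodule.coe_sub, Submodule.coe_smul, smul_sub,
        smul_comm]
    have h := hunique lam (⟨u, hu⟩ - b • ψ) (hlam0.trans hκ) hAd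
      (horth 0 lam e₀ _ (by simp [hAe₀]) hAd hlam0.ne')
      (by rw [Submodule.coe_sub, Submodule.coe_smul, inner_sub_right, inner_smul_right, hb,
            div_mul_cancel₀ _ hee, sub_self])
    exact ⟨b, Subtype.ext (sub_eq_zero.mp h).symm⟩
  · have hmem : (e₀ : H) ∈ eigenspace A 0 := ⟨e₀.2, by rw [zero_smul]; exact hAe₀⟩
    rw [finrank_eq_one_iff_of_nonzero' (⟨e₀, hmem⟩ : eigenspace A 0)
      fun h => he₀ (congrArg Subtype.val h)]
    rintro ⟨u, hu, hAu⟩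
    set b : ℂ := inner ℂ (e₀ : H) u / inner ℂ (e₀ : H) (e₀ : H) with hb
    have hee : inner ℂ (e₀ : H) (e₀ : H) ≠ 0 := inner_self_ne_zero.mpr he₀
    have hAd : A (⟨u, hu⟩ - b • e₀) = ((0 : ℝ) : ℂ) • ((⟨u, hu⟩ - b • e₀ : A.domain) : H) := by
      rw [A.map_sub, A.map_smul, hAu, hAe₀]
      simp
    have h := hunique 0 (⟨u, hu⟩ - b • e₀) hκ hAd
      (by rw [Submodule.coe_sub, Submodule.coe_smul, inner_sub_right, inner_smul_right, hb,
            div_mul_cancel₀ _ hee, sub_self])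
      (horth lam 0 ψ _ hψ hAd hlam0.ne)
    exact ⟨b, Subtype.ext (sub_eq_zero.mp h).symm⟩

end IsPerturbedInverse

end AbstractSpectrum

end PulseLinearization

namespace PulseLinearization

noncomputable section

/-! ### `H²(ℝ)` as the range of a Bessel potential, and density of Schwartz functions -/

section Sobolev

open TemperedDistribution FourierTransform
open scoped LineDeriv Real

theorem derivCLM_eq_lineDerivOp (T : 𝓢'(ℝ, ℂ)) :
    TemperedDistribution.derivCLM ℂ T = ∂_{(1 : ℝ)} T := by
  ext g
  rw [TemperedDistribution.derivCLM_apply_apply, TemperedDistribution.lineDerivOp_apply_apply]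
  congr 2

/-- In the Fourier convention with `2π` in the exponent, `d²` has symbol `-(2π)² ξ²`, hence the
factor `(2π)⁻²`. -/
theorem besselPotential_two_eq (T : 𝓢'(ℝ, ℂ)) :
    besselPotential ℝ ℂ 2 T = T - (((2 * π) ^ 2 : ℝ) : ℂ)⁻¹ •
      TemperedDistribution.derivCLM ℂ (TemperedDistribution.derivCLM ℂ T) := by
  have h1 : besselPotential ℝ ℂ 2 T = fourierMultiplierCLM ℂ (fun _ : ℝ => (1 : ℂ)) T +
      fourierMultiplierCLM ℂ (fun x : ℝ => (inner ℝ x (1 : ℝ) * inner ℝ x (1 : ℝ) : ℂ)) T := by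
    have hg : (fun _ : ℝ => (1 : ℂ)).HasTemperateGrowth := by fun_prop
    have hg' : (fun x : ℝ => (inner ℝ x (1 : ℝ) * inner ℝ x (1 : ℝ) : ℂ)).HasTemperateGrowth := by
      fun_prop
    simp only [besselPotential, fourierMultiplierCLM_apply]
    rw [← FourierTransform.fourierInv_add, ← add_apply, ← smulLeftCLM_add hg hg']
    congr 3
    ext x
    simp [sq]
  have h2 : TemperedDistribution.derivCLM ℂ (TemperedDistribution.derivCLM ℂ T) =
      (2 * π * Complex.I) • (2 * π * Complex.I) • fourierMultiplierCLM ℂ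
        (fun x : ℝ => (inner ℝ x (1 : ℝ) * inner ℝ x (1 : ℝ) : ℂ)) T := by
    rw [derivCLM_eq_lineDerivOp, derivCLM_eq_lineDerivOp, lineDeriv_eq_fourierMultiplierCLM,
      lineDeriv_eq_fourierMultiplierCLM, map_smul,
      fourierMultiplierCLM_fourierMultiplierCLM_apply (by fun_prop) (by fun_prop)]
    rfl
  rw [h1, h2, fourierMultiplierCLM_const, smul_smul, smul_smul, mul_assoc _ (2 * (π : ℂ) * Complex.I)]
  have : (((2 * π) ^ 2 : ℝ) : ℂ)⁻¹ * (2 * π * Complex.I * (2 * π * Complex.I)) = -1 := by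
    have : (2 * π * Complex.I * (2 * π * Complex.I)) = -(((2 * π) ^ 2 : ℝ) : ℂ) := by
      push_cast
      linear_combination (2 * π : ℂ) ^ 2 * Complex.I_sq
    rw [this, mul_neg, inv_mul_cancel₀]
    exact_mod_cast (by positivity : ((2 * π) ^ 2 : ℝ) ≠ 0)
  rw [this]
  simp

theorem mem_H2_of_distribDeriv2 {u w : L2} (h : (w : 𝓢'(ℝ, ℂ)) = distribDeriv2 u) : u ∈ H2 := by
  refine ⟨u - (((2 * π) ^ 2 : ℝ) : ℂ)⁻¹ • w, ?_⟩
  rw [besselPotential_two_eq, ← distribDeriv2, ← h]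
  simp only [← Lp.toTemperedDistributionCLM_apply, map_sub, map_smul]

theorem secondDeriv_eq_of_distribDeriv2 {u w : L2} (h : (w : 𝓢'(ℝ, ℂ)) = distribDeriv2 u)
    (hu : u ∈ H2) : secondDeriv ⟨u, hu⟩ = w :=
  toTemperedDistribution_injective (by rw [secondDeriv_spec, h])

/-- The symbol `(1 + ξ²)⁻¹`. -/
def besselSymbol (ξ : ℝ) : ℂ := ((1 + ‖ξ‖ ^ 2) ^ (-2 / 2 : ℝ) : ℝ)

theorem norm_besselSymbol_le (ξ : ℝ) : ‖besselSymbol ξ‖ ≤ 1 := by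
  rw [besselSymbol, Complex.norm_real, Real.norm_eq_abs, abs_of_nonneg (by positivity)]
  exact Real.rpow_le_one_of_one_le_of_nonpos (by simpa using sq_nonneg ξ) (by norm_num)

theorem besselSymbol_hasTemperateGrowth : besselSymbol.HasTemperateGrowth := by
  unfold besselSymbol
  fun_prop

theorem besselSymbol_memLp : MemLp besselSymbol ∞ (volume : Measure ℝ) :=
  memLp_top_of_bound besselSymbol_hasTemperateGrowth.1.continuous.aestronglyMeasurable 1
    (Eventually.of_forall norm_besselSymbol_le)

/-- Multiplication by an essentially bounded function as a bounded operator. -/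
def mulCLM {V : ℝ → ℂ} (hV : MemLp V ∞ (volume : Measure ℝ)) : L2 →L[ℂ] L2 :=
  (mulOp hV).mkContinuous ‖hV.toLp V‖ fun u => Lp.norm_smul_le (hV.toLp V) u

theorem mulCLM_apply {V : ℝ → ℂ} (hV : MemLp V ∞ (volume : Measure ℝ)) (u : L2) :
    mulCLM hV u = mulOp hV u := rfl

theorem inner_mulOp_left {V : ℝ → ℂ} (hV : MemLp V ∞ (volume : Measure ℝ))
    (hreal : ∀ x, starRingEnd ℂ (V x) = V x) (u v : L2) :
    inner ℂ (mulOp hV u) v = inner ℂ u (mulOp hV v) := by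
  rw [L2.inner_def, L2.inner_def]
  refine integral_congr_ae ?_
  filter_upwards [mulOp_ae hV u, mulOp_ae hV v] with x h1 h2
  rw [h1, h2]
  simp only [RCLike.inner_apply, map_mul, hreal]
  ring

/-- The bounded inverse of `1 - (2π)⁻² d²/dx²` on `L²(ℝ)`. -/
def besselInv : L2 →L[ℂ] L2 :=
  (Lp.fourierTransformₗᵢ ℝ ℂ).symm.toContinuousLinearEquiv.toContinuousLinearMap ∘L
    mulCLM besselSymbol_memLp ∘L
    (Lp.fourierTransformₗᵢ ℝ ℂ).toContinuousLinearEquiv.toContinuousLinearMap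

theorem besselInv_apply (h : L2) : besselInv h = 𝓕⁻ (mulOp besselSymbol_memLp (𝓕 h)) := rfl

theorem besselInv_symm (f g : L2) : inner ℂ (besselInv f) g = inner ℂ f (besselInv g) := by
  rw [← Lp.inner_fourier_eq, ← Lp.inner_fourier_eq f, besselInv_apply, besselInv_apply,
    fourier_fourierInv_eq, fourier_fourierInv_eq]
  exact inner_mulOp_left _ (fun x => Complex.conj_ofReal _) _ _

theorem besselInv_toTemperedDistribution (h : L2) :
    (besselInv h : 𝓢'(ℝ, ℂ)) = besselPotential ℝ ℂ (-2) h := by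
  rw [besselInv_apply, besselPotential, fourierMultiplierCLM_apply,
    ← Lp.fourierInv_toTemperedDistribution_eq, Lp.fourier_toTemperedDistribution_eq]
  congr 1
  exact Lp.toTemperedDistribution_smul_eq besselSymbol_hasTemperateGrowth besselSymbol_memLp (𝓕 h)

theorem besselInv_mem_H2 (h : L2) : besselInv h ∈ H2 := by
  refine ⟨h, ?_⟩
  rw [besselInv_toTemperedDistribution, besselPotential_besselPotential_apply]
  simp

theorem exists_besselInv_eq {u : L2} (hu : u ∈ H2) : ∃ h, besselInv h = u := by
  obtain ⟨h, hh⟩ := hu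
  refine ⟨h, toTemperedDistribution_injective ?_⟩
  rw [besselInv_toTemperedDistribution, ← hh, besselPotential_besselPotential_apply]
  simp

theorem secondDeriv_besselInv (h : L2) (hu : besselInv h ∈ H2) :
    secondDeriv ⟨besselInv h, hu⟩ = (((2 * π) ^ 2 : ℝ) : ℂ) • (besselInv h - h) := by
  refine secondDeriv_eq_of_distribDeriv2 ?_ hu
  have h1 : besselPotential ℝ ℂ 2 (besselInv h : 𝓢'(ℝ, ℂ)) = h := by
    rw [besselInv_toTemperedDistribution, besselPotential_besselPotential_apply]
    simp
  rw [besselPotential_two_eq, ← distribDeriv2, sub_eq_iff_eq_add, ← sub_eq_iff_eq_add'] at h1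
  have hne : (((2 * π) ^ 2 : ℝ) : ℂ) ≠ 0 := by
    exact_mod_cast (by positivity : ((2 * π) ^ 2 : ℝ) ≠ 0)
  rw [← smul_inv_smul₀ hne (distribDeriv2 (besselInv h)), ← h1]
  simp only [← Lp.toTemperedDistributionCLM_apply, map_sub, map_smul]

/-- If `u = R h` with `R = (1 - (2π)⁻² d²)⁻¹`, then `-u'' = (2π)² (h - u)`; the term `-m (2π)² u` is
moved into the bounded perturbation. -/
theorem isPerturbedInverse_linearized {ν : ℝ} {r : ℝ → ℝ} (hr : IsPulse ν r) (hm : mass ν ≠ 0) :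
    IsPerturbedInverse (linearized hr) besselInv
      (mulCLM hr.potential_memLp - ((mass ν * (2 * π) ^ 2 : ℝ) : ℂ) • ContinuousLinearMap.id ℂ L2)
      (mass ν * (2 * π) ^ 2) where
  ne_zero := mul_ne_zero hm (by positivity)
  symm_inv := besselInv_symm
  symm_pert f g := by
    simp only [sub_apply, smul_apply, ContinuousLinearMap.id_apply, inner_sub_left,
      inner_sub_right, inner_smul_left, inner_smul_right, Complex.conj_ofReal, mulCLM_apply]
    rw [inner_mulOp_left _ fun x => Complex.conj_ofReal _]
  mem_domain := besselInv_mem_H2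
  map_eq h := by
    change -(mass ν : ℂ) • secondDeriv ⟨besselInv h, _⟩ + mulOp hr.potential_memLp (besselInv h) = _
    rw [secondDeriv_besselInv]
    simp only [sub_apply, smul_apply, ContinuousLinearMap.id_apply, mulCLM_apply,
      Complex.ofReal_mul, smul_sub, neg_smul, mul_smul]
    abel
  exists_eq u := by
    obtain ⟨h, hh⟩ := exists_besselInv_eq u.2
    exact ⟨h, Subtype.ext hh.symm⟩

theorem besselInv_toLp (g : 𝓢(ℝ, ℂ)) :
    besselInv (g.toLp 2 : L2) = (SchwartzMap.fourierMultiplierCLM ℂ besselSymbol g).toLp 2 := by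
  refine toTemperedDistribution_injective ?_
  rw [besselInv_toTemperedDistribution, Lp.toTemperedDistribution_toLp_eq,
    Lp.toTemperedDistribution_toLp_eq, besselPotential]
  exact fourierMultiplierCLM_toTemperedDistributionCLM_eq besselSymbol_hasTemperateGrowth g

theorem secondDeriv_schwartz {u : L2} {k : 𝓢(ℝ, ℂ)} (hk : u = k.toLp 2) (hu : u ∈ H2) :
    secondDeriv ⟨u, hu⟩ = (SchwartzMap.derivCLM ℂ ℂ (SchwartzMap.derivCLM ℂ ℂ k)).toLp 2 := by
  refine secondDeriv_eq_of_distribDeriv2 ?_ hu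
  rw [hk, distribDeriv2, Lp.toTemperedDistribution_toLp_eq, Lp.toTemperedDistribution_toLp_eq,
    TemperedDistribution.derivCLM_toTemperedDistributionCLM_eq ℂ,
    TemperedDistribution.derivCLM_toTemperedDistributionCLM_eq ℂ]

/-- Density principle: a continuous inequality for the pair `(u, u'')` holds on `H²(ℝ)` as soon as
it holds for Schwartz functions. -/
theorem nonneg_of_schwartz {Φ : L2 → L2 → ℝ} (hΦ : Continuous fun p : L2 × L2 => Φ p.1 p.2)
    (h : ∀ k : 𝓢(ℝ, ℂ), 0 ≤ Φ (k.toLp 2)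
      ((SchwartzMap.derivCLM ℂ ℂ (SchwartzMap.derivCLM ℂ ℂ k)).toLp 2)) (u : H2) :
    0 ≤ Φ (u : L2) (secondDeriv u) := by
  obtain ⟨u, hu⟩ := u
  obtain ⟨f, rfl⟩ := exists_besselInv_eq hu
  rw [secondDeriv_besselInv]
  -- Pulled back through `besselInv`, the inequality becomes a closed condition on `f ∈ L²`. The
  -- Bessel multiplier preserves Schwartz functions, so on that dense set the hypothesis applies to
  -- the image.
  refine DenseRange.induction_on
    (p := fun f => 0 ≤ Φ (besselInv f) ((((2 * π) ^ 2 : ℝ) : ℂ) • (besselInv f - f)))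
    (SchwartzMap.denseRange_toLpCLM (p := 2) (F := ℂ) (μ := (volume : Measure ℝ))
      ENNReal.ofNat_ne_top) f ?_ fun g => ?_
  · refine isClosed_le continuous_const (hΦ.comp (Continuous.prodMk ?_ ?_))
    · exact besselInv.continuous
    · exact (besselInv.continuous.sub continuous_id).const_smul (((2 * π) ^ 2 : ℝ) : ℂ)
  · change 0 ≤ Φ (besselInv (g.toLp 2 : L2))
      ((((2 * π) ^ 2 : ℝ) : ℂ) • (besselInv (g.toLp 2 : L2) - (g.toLp 2 : L2)))
    rw [← secondDeriv_besselInv _ (besselInv_mem_H2 _), secondDeriv_schwartz (besselInv_toLp g)]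
    rw [besselInv_toLp g]
    exact h _

/-- Two integrations by parts against a Schwartz function identify the distributional derivative.
The uniform bounds make the products with Schwartz functions integrable; square integrability of
`f'` is not required. -/
theorem exists_mem_H2_of_hasDerivAt {f f' f'' : ℝ → ℝ} (hf : ∀ x, HasDerivAt f (f' x) x)
    (hf' : ∀ x, HasDerivAt f' (f'' x) x) (hc : Continuous f'') {M : ℝ} (hb : ∀ x, |f x| ≤ M)
    (hb' : ∀ x, |f' x| ≤ M) (hb'' : ∀ x, |f'' x| ≤ M)
    (hL : MemLp (fun x => (f x : ℂ)) 2 (volume : Measure ℝ))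
    (hL'' : MemLp (fun x => (f'' x : ℂ)) 2 (volume : Measure ℝ)) :
    ∃ hu : hL.toLp _ ∈ H2, secondDeriv ⟨hL.toLp _, hu⟩ = hL''.toLp _ := by
  suffices h : ((hL''.toLp _ : L2) : 𝓢'(ℝ, ℂ)) = distribDeriv2 (hL.toLp _) from
    ⟨mem_H2_of_distribDeriv2 h, secondDeriv_eq_of_distribDeriv2 h _⟩
  ext g
  rw [distribDeriv2, TemperedDistribution.derivCLM_apply_apply,
    TemperedDistribution.derivCLM_apply_apply, map_neg, map_neg, map_neg,
    neg_neg, Lp.toTemperedDistribution_apply,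
    Lp.toTemperedDistribution_apply]
  set g₁ := SchwartzMap.derivCLM ℂ ℂ g with hg₁
  set g₂ := SchwartzMap.derivCLM ℂ ℂ g₁ with hg₂
  have hd : ∀ x, HasDerivAt (fun y => (f y : ℂ)) (f' x : ℂ) x := fun x => (hf x).ofReal_comp
  have hd' : ∀ x, HasDerivAt (fun y => (f' y : ℂ)) (f'' x : ℂ) x := fun x => (hf' x).ofReal_comp
  have hint : ∀ (φ : ℝ → ℝ) (k : 𝓢(ℝ, ℂ)), Continuous φ → (∀ x, |φ x| ≤ M) →
      Integrable ((fun x => (φ x : ℂ)) * (k : ℝ → ℂ)) volume := fun φ k hφ hφb =>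
    k.integrable.bdd_mul (Complex.continuous_ofReal.comp hφ).aestronglyMeasurable
      (Eventually.of_forall fun x => (Complex.norm_real (φ x)).trans_le (hφb x))
  have hcf : Continuous f := continuous_iff_continuousAt.mpr fun x => (hf x).continuousAt
  have hcf' : Continuous f' := continuous_iff_continuousAt.mpr fun x => (hf' x).continuousAt
  have e1 := integral_mul_deriv_eq_deriv_mul_of_integrable (fun x _ => hd x)
    (fun x _ => g₁.hasDerivAt x) (hint f g₂ hcf hb) (hint f' g₁ hcf' hb') (hint f g₁ hcf hb)
  have e2 := integral_mul_deriv_eq_deriv_mul_of_integrable (fun x _ => hd' x)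
    (fun x _ => g.hasDerivAt x) (hint f' g₁ hcf' hb') (hint f'' g hc hb'') (hint f' g hcf' hb')
  calc ∫ x, g x • (hL''.toLp _ : ℝ → ℂ) x = ∫ x, (f'' x : ℂ) * g x := by
        refine integral_congr_ae ?_
        filter_upwards [hL''.coeFn_toLp] with x hx
        rw [hx, smul_eq_mul, mul_comm]
    _ = ∫ x, (f x : ℂ) * g₂ x := by
        refine Eq.trans ?_ e1.symm
        exact neg_eq_iff_eq_neg.mp e2.symm
    _ = ∫ x, g₂ x • (hL.toLp _ : ℝ → ℂ) x := by
        refine integral_congr_ae ?_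
        filter_upwards [hL.coeFn_toLp] with x hx
        rw [hx, smul_eq_mul, mul_comm]

end Sobolev

end

end PulseLinearization

namespace PulseLinearization

noncomputable section

/-! ### The explicit formula for the pulse and its potential -/

section Pulse

/-- `D(x) = 1 + √ν cosh 2x`. -/
def frontDenom (ν x : ℝ) : ℝ := 1 + √ν * Real.cosh (2 * x)

theorem one_le_frontDenom (ν x : ℝ) : 1 ≤ frontDenom ν x := by
  have := Real.cosh_pos (2 * x)
  have : 0 ≤ √ν * Real.cosh (2 * x) := by positivity
  unfold frontDenom
  linarith

theorem frontDenom_pos (ν x : ℝ) : 0 < frontDenom ν x := one_pos.trans_le (one_le_frontDenom ν x)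

theorem hasDerivAt_cosh_two_mul (x : ℝ) :
    HasDerivAt (fun y => Real.cosh (2 * y)) (2 * Real.sinh (2 * x)) x := by
  have h1 : HasDerivAt (fun y : ℝ => 2 * y) 2 x := by simpa using (hasDerivAt_id x).const_mul (2 : ℝ)
  exact ((Real.hasDerivAt_cosh (2 * x)).comp x h1).congr_deriv (mul_comm _ _)

theorem hasDerivAt_sinh_two_mul (x : ℝ) :
    HasDerivAt (fun y => Real.sinh (2 * y)) (2 * Real.cosh (2 * x)) x := by
  have h1 : HasDerivAt (fun y : ℝ => 2 * y) 2 x := by simpa using (hasDerivAt_id x).const_mul (2 : ℝ)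
  exact ((Real.hasDerivAt_sinh (2 * x)).comp x h1).congr_deriv (mul_comm _ _)

theorem hasDerivAt_frontDenom (ν x : ℝ) :
    HasDerivAt (frontDenom ν) (2 * √ν * Real.sinh (2 * x)) x := by
  refine (((hasDerivAt_cosh_two_mul x).const_mul (√ν)).const_add 1).congr_deriv ?_
  ring

/-- A solution of `G'' = 4 G` with `G'(0) = 0` is a multiple of `cosh 2x`. -/
theorem eq_cosh_of_ode {G G' : ℝ → ℝ} (hG : ∀ x, HasDerivAt G (G' x) x)
    (hG' : ∀ x, HasDerivAt G' (4 * G x) x) (h0 : G' 0 = 0) (x : ℝ) :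
    G x = G 0 * Real.cosh (2 * x) := by
  -- Two first integrals, the Wronskians with `cosh 2y` and `sinh 2y` up to scaling; `cosh² - sinh²
  -- = 1` then recovers `G`.
  have ha : ∀ y, HasDerivAt (fun y => G y * Real.cosh (2 * y) - G' y * Real.sinh (2 * y) / 2) 0 y :=
    fun y => by
    refine (((hG y).mul (hasDerivAt_cosh_two_mul y)).sub
      (((hG' y).mul (hasDerivAt_sinh_two_mul y)).div_const 2)).congr_deriv ?_
    ring
  have hb : ∀ y, HasDerivAt (fun y => G' y * Real.cosh (2 * y) - 2 * G y * Real.sinh (2 * y)) 0 y :=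
    fun y => by
    refine (((hG' y).mul (hasDerivAt_cosh_two_mul y)).sub
      (((hG y).const_mul 2).mul (hasDerivAt_sinh_two_mul y))).congr_deriv ?_
    ring
  have ha' := is_const_of_deriv_eq_zero (fun y => (ha y).differentiableAt)
    (fun y => (ha y).deriv) x 0
  have hb' := is_const_of_deriv_eq_zero (fun y => (hb y).differentiableAt)
    (fun y => (hb y).deriv) x 0
  simp [h0] at ha' hb'
  have := Real.cosh_sq (2 * x)
  linear_combination (Real.cosh (2 * x)) * ha' + Real.sinh (2 * x) / 2 * hb' - G x * this

theorem IsPulse.hasDerivAt {ν : ℝ} {r : ℝ → ℝ} (hr : IsPulse ν r) (x : ℝ) :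
    HasDerivAt r (deriv r x) x :=
  (hr.contDiff.differentiable (by norm_num) x).hasDerivAt

theorem IsPulse.hasDerivAt_deriv {ν : ℝ} {r : ℝ → ℝ} (hr : IsPulse ν r) (x : ℝ) :
    HasDerivAt (deriv r) (deriv (deriv r) x) x := by
  have h : ContDiff ℝ 1 (deriv r) := by
    have h2 : ContDiff ℝ (1 + 1) r := by norm_num; exact hr.contDiff
    exact (contDiff_succ_iff_deriv.mp h2).2.2
  exact (h.differentiable (by norm_num) x).hasDerivAt

/-- The energy is conserved, so its value can be read off at infinity. Decay of `r'` is not assumed,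
but the mean value theorem on `[n, n + 1]` supplies points `ξ n → ∞` with `r'(ξ n) → 0`, which is
enough. -/
theorem IsPulse.energy {ν : ℝ} {r : ℝ → ℝ} (hr : IsPulse ν r) (x : ℝ) :
    mass ν * deriv r x ^ 2 - mass ν * r x ^ 2 + r x ^ 4 / 2 - r x ^ 6 / 3 = 0 := by
  set E : ℝ → ℝ := fun x => mass ν * deriv r x ^ 2 - mass ν * r x ^ 2 + r x ^ 4 / 2 - r x ^ 6 / 3
    with hE
  have hd : ∀ y, HasDerivAt E 0 y := fun y => by
    refine (((((hr.hasDerivAt_deriv y).pow 2).const_mul (mass ν)).sub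
      (((hr.hasDerivAt y).pow 2).const_mul (mass ν))).add
      (((hr.hasDerivAt y).pow 4).div_const 2)).sub
      (((hr.hasDerivAt y).pow 6).div_const 3) |>.congr_deriv ?_
    have := hr.ode y
    push_cast
    linear_combination (-2 * deriv r y) * this
  have hconst : ∀ y, E y = E x := fun y =>
    is_const_of_deriv_eq_zero (fun y => (hd y).differentiableAt) (fun y => (hd y).deriv) y x
  have htop : Tendsto r atTop (𝓝 0) := hr.tendsto_zero.mono_left atTop_le_cocompact
  have hmv : ∀ n : ℕ, ∃ ξ ∈ Ioo (n : ℝ) (n + 1), deriv r ξ = r (n + 1) - r n := fun n => by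
    obtain ⟨ξ, hξ, h⟩ := exists_deriv_eq_slope r (lt_add_one (n : ℝ))
      hr.contDiff.continuous.continuousOn
      (hr.contDiff.differentiable (by norm_num)).differentiableOn
    exact ⟨ξ, hξ, by simpa using h⟩
  choose ξ hξ hξd using hmv
  have hξt : Tendsto ξ atTop atTop :=
    tendsto_atTop_mono (fun n => (hξ n).1.le) tendsto_natCast_atTop_atTop
  have hrξ : Tendsto (fun n => r (ξ n)) atTop (𝓝 0) := htop.comp hξt
  have hdξ : Tendsto (fun n => deriv r (ξ n)) atTop (𝓝 0) := by
    simp only [hξd]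
    have h1 : Tendsto (fun n : ℕ => r (n : ℝ)) atTop (𝓝 0) := htop.comp tendsto_natCast_atTop_atTop
    have h2 : Tendsto (fun n : ℕ => r ((n : ℝ) + 1)) atTop (𝓝 0) :=
      htop.comp (tendsto_natCast_atTop_atTop.atTop_add tendsto_const_nhds)
    simpa using h2.sub h1
  have hlim : Tendsto (fun n => E (ξ n)) atTop (𝓝 0) := by
    have := ((((hdξ.pow 2).const_mul (mass ν)).sub ((hrξ.pow 2).const_mul (mass ν))).add
      ((hrξ.pow 4).div_const 2)).sub ((hrξ.pow 6).div_const 3)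
    simpa using this
  simp only [hconst] at hlim
  exact tendsto_nhds_unique tendsto_const_nhds hlim

/-- The pulse is explicit. -/
theorem IsPulse.sq_eq {ν : ℝ} (hν : ν ∈ Ioo (0 : ℝ) 1) {r : ℝ → ℝ} (hr : IsPulse ν r) (x : ℝ) :
    r x ^ 2 = 4 * mass ν / frontDenom ν x := by
  have hm : 0 < mass ν := by unfold mass; linarith [hν.2]
  have hc0 : 0 < √ν := Real.sqrt_pos.mpr hν.1
  have hr0 : ∀ y, r y ≠ 0 := fun y => (hr.pos y).ne'
  -- This substitution linearizes the equation: the ODE together with the energy identity gives `G''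
  -- = 4G`.
  set G : ℝ → ℝ := fun y => 4 * mass ν / r y ^ 2 - 1 with hGdef
  have hG : ∀ y, HasDerivAt G (-(8 * mass ν * deriv r y) / r y ^ 3) y := fun y => by
    refine (((hasDerivAt_const y (4 * mass ν)).div ((hr.hasDerivAt y).pow 2)
      (pow_ne_zero 2 (hr0 y))).sub_const 1).congr_deriv ?_
    have := hr0 y
    rw [Pi.pow_apply]
    field_simp
    ring
  have hG' : ∀ y, HasDerivAt (fun y => -(8 * mass ν * deriv r y) / r y ^ 3) (4 * G y) y :=
    fun y => by
    refine ((((hr.hasDerivAt_deriv y).const_mul (8 * mass ν)).neg).div ((hr.hasDerivAt y).pow 3)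
      (pow_ne_zero 3 (hr0 y))).congr_deriv ?_
    have h1 := hr0 y
    have h2 := hr.ode y
    have h3 := hr.energy y
    simp only [Pi.pow_apply, Pi.neg_apply, hGdef]
    field_simp
    push_cast
    linear_combination 8 * r y ^ 3 * h2 + 24 * r y ^ 2 * h3
  have hd0 : deriv r 0 = 0 := by
    have h1 : HasDerivAt (fun y => r (-y)) (-deriv r 0) 0 := by
      have h := hr.hasDerivAt (-0)
      exact (HasDerivAt.comp (0 : ℝ) h (hasDerivAt_neg (0 : ℝ))).congr_deriv (by simp)
    have h2 : (fun y => r (-y)) = r := funext hr.even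
    rw [h2] at h1
    have := h1.unique (hr.hasDerivAt 0)
    linarith
  have hsol := eq_cosh_of_ode hG hG' (by simp [hd0])
  -- The energy identity at 0, where `r' = 0` by evenness, is a quadratic equation for `r(0)²`. The
  -- root `G 0 = -√ν` is excluded below because `1 + G > 0` while `cosh` is unbounded.
  have hsq : G 0 ^ 2 = ν := by
    have h3 := hr.energy 0
    rw [hd0] at h3
    have h1 := hr0 0
    have h4 : r 0 ^ 4 / 3 - r 0 ^ 2 / 2 + mass ν = 0 := by
      have : r 0 ^ 2 * (r 0 ^ 4 / 3 - r 0 ^ 2 / 2 + mass ν) = 0 := by linear_combination -h3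
      exact (mul_eq_zero.mp this).resolve_left (pow_ne_zero 2 h1)
    have h5 : ν = 1 - 16 / 3 * mass ν := by unfold mass; ring
    have h6 : (4 * mass ν / r 0 ^ 2 - 1) ^ 2 = 1 - 16 / 3 * mass ν := by
      field_simp
      linear_combination (48 * mass ν) * h4
    rw [← h5] at h6
    exact h6
  have hG0 : G 0 = √ν := by
    rcases le_or_gt 0 (G 0) with h | h
    · rw [← hsq, Real.sqrt_sq h]
    · exfalso
      have hG1 : G 0 = -√ν := by rw [← hsq, Real.sqrt_sq_eq_abs, abs_of_neg h, neg_neg]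
      have h1 : ∀ y, √ν * Real.cosh (2 * y) < 1 := fun y => by
        have h2 := hsol y
        rw [hG1] at h2
        have h3 : 0 < 4 * mass ν / r y ^ 2 := by have := hr.pos y; positivity
        have h4 : G y = 4 * mass ν / r y ^ 2 - 1 := rfl
        linarith
      have h2 := h1 ((√ν)⁻¹)
      have h3 : (√ν)⁻¹ ≤ Real.cosh (2 * (√ν)⁻¹) := by
        have hpos : 0 < (√ν)⁻¹ := by positivity
        have h5 := Real.add_one_le_exp (2 * (√ν)⁻¹)
        have h6 := Real.exp_pos (-(2 * (√ν)⁻¹))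
        rw [Real.cosh_eq]
        linarith
      have h4 := mul_le_mul_of_nonneg_left h3 hc0.le
      rw [mul_inv_cancel₀ hc0.ne'] at h4
      linarith
  have h1 := hsol x
  rw [hG0] at h1
  have h2 : 4 * mass ν / r x ^ 2 = frontDenom ν x := by
    have h4 : G x = 4 * mass ν / r x ^ 2 - 1 := rfl
    unfold frontDenom
    linarith
  have h3 := frontDenom_pos ν x
  have h4 := hr0 x
  rw [← h2]
  field_simp

/-- The potential divided by `m`, in explicit form. -/
def scaledPotential (ν x : ℝ) : ℝ :=
  1 - 12 / frontDenom ν x + 15 * (1 - ν) / frontDenom ν x ^ 2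

theorem IsPulse.potential_eq {ν : ℝ} (hν : ν ∈ Ioo (0 : ℝ) 1) {r : ℝ → ℝ} (hr : IsPulse ν r)
    (x : ℝ) : potential ν r x = mass ν * scaledPotential ν x := by
  have h1 : r x ^ 4 = (4 * mass ν / frontDenom ν x) ^ 2 := by rw [← hr.sq_eq hν x]; ring
  have h3 := (frontDenom_pos ν x).ne'
  rw [potential, h1, hr.sq_eq hν x, scaledPotential]
  have h5 : ν = 1 - 16 / 3 * mass ν := by unfold mass; ring
  have h6 : 1 - ν = 16 / 3 * mass ν := by linarith
  rw [h6]
  field_simp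
  ring

theorem continuous_frontDenom (ν : ℝ) : Continuous (frontDenom ν) := by
  unfold frontDenom
  fun_prop

theorem continuous_scaledPotential (ν : ℝ) : Continuous (scaledPotential ν) := by
  have h := continuous_frontDenom ν
  have h0 : ∀ x, frontDenom ν x ≠ 0 := fun x => (frontDenom_pos ν x).ne'
  unfold scaledPotential
  fun_prop (disch := simp [h0])

/-- The crude bound `1 + 12 + 15` serves integrability and boundedness only; the spectral constants
do not depend on it. -/
theorem abs_scaledPotential_le {ν : ℝ} (hν : ν ∈ Ioo (0 : ℝ) 1) (x : ℝ) :
    |scaledPotential ν x| ≤ 28 := by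
  have h1 := one_le_frontDenom ν x
  have h2 : 1 / frontDenom ν x ≤ 1 := by rw [div_le_one (by linarith)]; exact h1
  have h3 : 0 ≤ 1 / frontDenom ν x := by positivity
  have h4 : scaledPotential ν x =
      1 - 12 * (1 / frontDenom ν x) + 15 * (1 - ν) * (1 / frontDenom ν x) ^ 2 := by
    unfold scaledPotential; ring
  obtain ⟨h5, h6⟩ := hν
  set p := 1 / frontDenom ν x
  have h7 : 0 ≤ p ^ 2 := sq_nonneg p
  have h8 : p ^ 2 ≤ 1 := by nlinarith
  have h9 : 0 ≤ (1 - ν) * p ^ 2 := mul_nonneg (by linarith) h7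
  have h10 : (1 - ν) * p ^ 2 ≤ 1 := by nlinarith
  rw [h4, abs_le]
  constructor <;> nlinarith

end Pulse

/-! ### The two approximate zero modes: equations, bounds and decay -/

section Modes

/-- The odd zero mode `sinh 2x / D^{3/2}`, a multiple of `r'`. -/
def oddMode (ν x : ℝ) : ℝ := Real.sinh (2 * x) / √(frontDenom ν x) ^ 3

/-- The derivative of `oddMode`. -/
def oddModeDeriv (ν x : ℝ) : ℝ :=
  2 * Real.cosh (2 * x) / √(frontDenom ν x) ^ 3 -
    3 * √ν * Real.sinh (2 * x) ^ 2 / √(frontDenom ν x) ^ 5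

/-- The even approximate zero mode `cosh 2x / D^{3/2}`. -/
def evenMode (ν x : ℝ) : ℝ := Real.cosh (2 * x) / √(frontDenom ν x) ^ 3

/-- The derivative of `evenMode`. -/
def evenModeDeriv (ν x : ℝ) : ℝ :=
  2 * Real.sinh (2 * x) / √(frontDenom ν x) ^ 3 -
    3 * √ν * Real.sinh (2 * x) * Real.cosh (2 * x) / √(frontDenom ν x) ^ 5

/-- The excess `12 √ν / (D cosh 2x)` of the potential which annihilates `evenMode`. -/
def excess (ν x : ℝ) : ℝ := 12 * √ν / (frontDenom ν x * Real.cosh (2 * x))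

theorem sqrt_frontDenom_pos (ν x : ℝ) : 0 < √(frontDenom ν x) :=
  Real.sqrt_pos.mpr (frontDenom_pos ν x)

theorem sq_sqrt_frontDenom (ν x : ℝ) : √(frontDenom ν x) ^ 2 = frontDenom ν x :=
  Real.sq_sqrt (frontDenom_pos ν x).le

theorem hasDerivAt_sqrt_frontDenom (ν x : ℝ) :
    HasDerivAt (fun y => √(frontDenom ν y)) (√ν * Real.sinh (2 * x) / √(frontDenom ν x)) x := by
  refine ((hasDerivAt_frontDenom ν x).sqrt (frontDenom_pos ν x).ne').congr_deriv ?_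
  have := (sqrt_frontDenom_pos ν x).ne'
  field_simp

theorem hasDerivAt_oddMode (ν x : ℝ) : HasDerivAt (oddMode ν) (oddModeDeriv ν x) x := by
  have hs := (sqrt_frontDenom_pos ν x).ne'
  refine ((hasDerivAt_sinh_two_mul x).div ((hasDerivAt_sqrt_frontDenom ν x).pow 3)
    (pow_ne_zero 3 hs)).congr_deriv ?_
  rw [oddModeDeriv, Pi.pow_apply]
  field_simp
  push_cast
  ring

theorem hasDerivAt_evenMode (ν x : ℝ) : HasDerivAt (evenMode ν) (evenModeDeriv ν x) x := by
  have hs := (sqrt_frontDenom_pos ν x).ne'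
  refine ((hasDerivAt_cosh_two_mul x).div ((hasDerivAt_sqrt_frontDenom ν x).pow 3)
    (pow_ne_zero 3 hs)).congr_deriv ?_
  rw [evenModeDeriv, Pi.pow_apply]
  field_simp
  push_cast
  ring

theorem scaledPotential_eq_sqrt {ν : ℝ} (hν : 0 ≤ ν) (x : ℝ) : scaledPotential ν x =
    1 - 12 / √(frontDenom ν x) ^ 2 + 15 * (1 - √ν ^ 2) / √(frontDenom ν x) ^ 4 := by
  rw [Real.sq_sqrt hν, show √(frontDenom ν x) ^ 4 = (√(frontDenom ν x) ^ 2) ^ 2 by ring,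
    sq_sqrt_frontDenom, scaledPotential]

/-- This is the pulse equation differentiated in `x`, since `oddMode` is proportional to `r'`. It is
checked directly: over the denominator `D^{7/2}` it becomes a polynomial identity modulo `s² = 1 +
cC` and `C² = S² + 1`. -/
theorem hasDerivAt_oddModeDeriv {ν : ℝ} (hν : 0 ≤ ν) (x : ℝ) :
    HasDerivAt (oddModeDeriv ν) (scaledPotential ν x * oddMode ν x) x := by
  have hs := (sqrt_frontDenom_pos ν x).ne'
  have hS := hasDerivAt_sqrt_frontDenom ν x
  refine ((((hasDerivAt_cosh_two_mul x).const_mul 2).div (hS.pow 3) (pow_ne_zero 3 hs)).sub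
    ((((hasDerivAt_sinh_two_mul x).pow 2).const_mul (3 * √ν)).div (hS.pow 5)
    (pow_ne_zero 5 hs))).congr_deriv ?_
  rw [scaledPotential_eq_sqrt hν, oddMode]
  simp only [Pi.pow_apply]
  have hD : √(frontDenom ν x) ^ 2 = 1 + √ν * Real.cosh (2 * x) := sq_sqrt_frontDenom ν x
  have hC := Real.cosh_sq (2 * x)
  generalize √(frontDenom ν x) = s at *
  generalize √ν = c at *
  generalize Real.cosh (2 * x) = C at *
  generalize Real.sinh (2 * x) = S at *
  push_cast
  trans (S * (4 * s ^ 4 - 18 * c * C * s ^ 2 + 15 * c ^ 2 * S ^ 2)) / s ^ 7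
  · field_simp
    ring
  trans (S * (s ^ 4 - 12 * s ^ 2 + 15 * (1 - c ^ 2))) / s ^ 7
  · congr 1
    linear_combination S * (-(15 * c * C - 3 * s ^ 2 - 15) * hD - 15 * c ^ 2 * hC)
  · field_simp

/-- The computation is that of the odd mode with `sinh` and `cosh` exchanged. As `cosh² - sinh²` has
the opposite sign under this exchange, a remainder `12 c s²` survives, and this is the excess. -/
theorem hasDerivAt_evenModeDeriv {ν : ℝ} (hν : 0 ≤ ν) (x : ℝ) :
    HasDerivAt (evenModeDeriv ν) ((scaledPotential ν x + excess ν x) * evenMode ν x) x := by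
  have hs := (sqrt_frontDenom_pos ν x).ne'
  have hS := hasDerivAt_sqrt_frontDenom ν x
  refine ((((hasDerivAt_sinh_two_mul x).const_mul 2).div (hS.pow 3) (pow_ne_zero 3 hs)).sub
    ((((hasDerivAt_sinh_two_mul x).const_mul (3 * √ν)).mul (hasDerivAt_cosh_two_mul x)).div
    (hS.pow 5) (pow_ne_zero 5 hs))).congr_deriv ?_
  rw [scaledPotential_eq_sqrt hν, evenMode, excess, ← sq_sqrt_frontDenom ν x]
  simp only [Pi.pow_apply, Pi.mul_apply, Real.sqrt_sq (sqrt_frontDenom_pos ν x).le]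
  have hD : √(frontDenom ν x) ^ 2 = 1 + √ν * Real.cosh (2 * x) := sq_sqrt_frontDenom ν x
  have hC := Real.cosh_sq (2 * x)
  have hC0 := (Real.cosh_pos (2 * x)).ne'
  generalize √(frontDenom ν x) = s at *
  generalize √ν = c at *
  generalize Real.cosh (2 * x) = C at *
  generalize Real.sinh (2 * x) = S at *
  push_cast
  trans (4 * C * s ^ 4 - 12 * c * S ^ 2 * s ^ 2 - 6 * c * C ^ 2 * s ^ 2 + 15 * c ^ 2 * S ^ 2 * C) /
    s ^ 7
  · field_simp
    ring
  trans (C * (s ^ 4 - 12 * s ^ 2 + 15 * (1 - c ^ 2)) + 12 * c * s ^ 2) / s ^ 7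
  · congr 1
    linear_combination -C * (15 * c * C - 3 * s ^ 2 - 15) * hD +
      (12 * c * s ^ 2 - 15 * c ^ 2 * C) * hC
  · field_simp

theorem continuous_oddMode (ν : ℝ) : Continuous (oddMode ν) :=
  continuous_iff_continuousAt.mpr fun x => (hasDerivAt_oddMode ν x).continuousAt

theorem continuous_evenMode (ν : ℝ) : Continuous (evenMode ν) :=
  continuous_iff_continuousAt.mpr fun x => (hasDerivAt_evenMode ν x).continuousAt

theorem continuous_excess (ν : ℝ) : Continuous (excess ν) := by
  have h := continuous_frontDenom ν
  have h0 : ∀ x, frontDenom ν x * Real.cosh (2 * x) ≠ 0 := fun x =>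
    (mul_pos (frontDenom_pos ν x) (Real.cosh_pos _)).ne'
  have h1 : Continuous fun x : ℝ => Real.cosh (2 * x) := by fun_prop
  exact continuous_const.div (h.mul h1) h0

theorem excess_pos {ν : ℝ} (hν : 0 < ν) (x : ℝ) : 0 < excess ν x := by
  have h1 := frontDenom_pos ν x
  have h2 := Real.cosh_pos (2 * x)
  have h3 : 0 < √ν := Real.sqrt_pos.mpr hν
  unfold excess
  positivity

theorem excess_le (ν x : ℝ) : excess ν x ≤ 12 * √ν := by
  have h1 := one_le_frontDenom ν x
  have h2 := Real.one_le_cosh (2 * x)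
  exact div_le_self (by positivity) (by nlinarith)

theorem evenMode_pos (ν x : ℝ) : 0 < evenMode ν x :=
  div_pos (Real.cosh_pos _) (pow_pos (sqrt_frontDenom_pos ν x) 3)

theorem oddMode_pos (ν : ℝ) {x : ℝ} (hx : 0 < x) : 0 < oddMode ν x :=
  div_pos (Real.sinh_pos_iff.mpr (by linarith)) (pow_pos (sqrt_frontDenom_pos ν x) 3)

theorem abs_sinh_le_cosh (x : ℝ) : |Real.sinh x| ≤ Real.cosh x := by
  refine abs_le_of_sq_le_sq ?_ (Real.cosh_pos x).le
  rw [Real.cosh_sq]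
  linarith

/-- `√ν cosh 2x ≤ D` trades the numerator for one power of `D`, leaving `D^{-1/2}`, which is square
integrable. -/
theorem abs_evenMode_le {ν : ℝ} (hν : 0 < ν) (x : ℝ) :
    |evenMode ν x| ≤ (√ν)⁻¹ / √(frontDenom ν x) := by
  have hs := sqrt_frontDenom_pos ν x
  have hc : 0 < √ν := Real.sqrt_pos.mpr hν
  rw [abs_of_pos (evenMode_pos ν x), evenMode, div_le_div_iff₀ (pow_pos hs 3) hs]
  have hD : √(frontDenom ν x) ^ 2 = 1 + √ν * Real.cosh (2 * x) := sq_sqrt_frontDenom ν x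
  have h1 : Real.cosh (2 * x) ≤ (√ν)⁻¹ * √(frontDenom ν x) ^ 2 := by
    rw [inv_mul_eq_div, le_div_iff₀ hc, hD]
    linarith
  calc Real.cosh (2 * x) * √(frontDenom ν x)
      ≤ ((√ν)⁻¹ * √(frontDenom ν x) ^ 2) * √(frontDenom ν x) := by gcongr
    _ = _ := by ring

theorem abs_oddMode_le_evenMode (ν x : ℝ) : |oddMode ν x| ≤ evenMode ν x := by
  rw [oddMode, evenMode, abs_div, abs_of_pos (pow_pos (sqrt_frontDenom_pos ν x) 3)]
  have := (pow_pos (sqrt_frontDenom_pos ν x) 3).le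
  gcongr
  exact abs_sinh_le_cosh _

theorem abs_oddMode_le {ν : ℝ} (hν : 0 < ν) (x : ℝ) :
    |oddMode ν x| ≤ (√ν)⁻¹ / √(frontDenom ν x) :=
  (abs_oddMode_le_evenMode ν x).trans ((le_abs_self _).trans (abs_evenMode_le hν x))

theorem one_le_sqrt_frontDenom (ν x : ℝ) : 1 ≤ √(frontDenom ν x) :=
  Real.one_le_sqrt.mpr (one_le_frontDenom ν x)

theorem evenMode_le {ν : ℝ} (hν : 0 < ν) (x : ℝ) : evenMode ν x ≤ (√ν)⁻¹ :=
  ((le_abs_self _).trans (abs_evenMode_le hν x)).trans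
    (div_le_self (by positivity) (one_le_sqrt_frontDenom ν x))

/-- The logarithmic derivative `-3 √ν sinh 2x / D` of `D^{-3/2}`. -/
def frontSlope (ν x : ℝ) : ℝ := 3 * √ν * Real.sinh (2 * x) / frontDenom ν x

theorem abs_frontSlope_le (ν x : ℝ) : |frontSlope ν x| ≤ 3 := by
  have h1 := frontDenom_pos ν x
  rw [frontSlope, abs_div, abs_of_pos h1, div_le_iff₀ h1, abs_mul,
    abs_of_nonneg (by positivity : 0 ≤ 3 * √ν)]
  have h2 := mul_le_mul_of_nonneg_left (abs_sinh_le_cosh (2 * x)) (Real.sqrt_nonneg ν)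
  unfold frontDenom
  linarith

theorem oddModeDeriv_eq (ν x : ℝ) :
    oddModeDeriv ν x = 2 * evenMode ν x - frontSlope ν x * oddMode ν x := by
  have hs := (sqrt_frontDenom_pos ν x).ne'
  rw [oddModeDeriv, evenMode, frontSlope, oddMode, ← sq_sqrt_frontDenom ν x,
    Real.sqrt_sq (sqrt_frontDenom_pos ν x).le]
  field_simp

theorem evenModeDeriv_eq (ν x : ℝ) :
    evenModeDeriv ν x = 2 * oddMode ν x - frontSlope ν x * evenMode ν x := by
  have hs := (sqrt_frontDenom_pos ν x).ne'
  rw [evenModeDeriv, evenMode, frontSlope, oddMode, ← sq_sqrt_frontDenom ν x,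
    Real.sqrt_sq (sqrt_frontDenom_pos ν x).le]
  field_simp

theorem abs_oddModeDeriv_le {ν : ℝ} (hν : 0 < ν) (x : ℝ) : |oddModeDeriv ν x| ≤ 5 * (√ν)⁻¹ := by
  rw [oddModeDeriv_eq]
  have h1 := evenMode_le hν x
  have h2 := abs_oddMode_le_evenMode ν x
  have h3 := abs_frontSlope_le ν x
  have h4 := evenMode_pos ν x
  calc |2 * evenMode ν x - frontSlope ν x * oddMode ν x|
      ≤ |2 * evenMode ν x| + |frontSlope ν x| * |oddMode ν x| := by
        rw [← abs_mul]; exact abs_sub _ _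
    _ ≤ 2 * evenMode ν x + 3 * evenMode ν x := by
        rw [abs_of_pos (by positivity)]; gcongr
    _ ≤ _ := by linarith

theorem abs_evenModeDeriv_le {ν : ℝ} (hν : 0 < ν) (x : ℝ) : |evenModeDeriv ν x| ≤ 5 * (√ν)⁻¹ := by
  rw [evenModeDeriv_eq]
  have h1 := evenMode_le hν x
  have h2 := abs_oddMode_le_evenMode ν x
  have h3 := abs_frontSlope_le ν x
  have h4 := evenMode_pos ν x
  calc |2 * oddMode ν x - frontSlope ν x * evenMode ν x|
      ≤ 2 * |oddMode ν x| + |frontSlope ν x| * evenMode ν x := by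
        have h := abs_sub (2 * oddMode ν x) (frontSlope ν x * evenMode ν x)
        rwa [abs_mul, abs_two, abs_mul (frontSlope ν x), abs_of_pos h4] at h
    _ ≤ 2 * evenMode ν x + 3 * evenMode ν x := by gcongr
    _ ≤ _ := by linarith

theorem le_frontDenom (ν x : ℝ) : √ν * (1 + x ^ 2) ≤ frontDenom ν x := by
  have h1 : x ^ 2 ≤ Real.sinh x ^ 2 := by
    rw [sq_le_sq, Real.abs_sinh]
    exact Real.self_le_sinh_iff.mpr (abs_nonneg x)
  have h2 : 1 + x ^ 2 ≤ Real.cosh (2 * x) := by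
    rw [Real.cosh_two_mul, Real.cosh_sq]
    nlinarith [sq_nonneg x]
  have := mul_le_mul_of_nonneg_left h2 (Real.sqrt_nonneg ν)
  unfold frontDenom
  linarith

theorem memLp_two_of_abs_le {ν : ℝ} (hν : 0 < ν) {f : ℝ → ℝ} (hf : Continuous f) {M : ℝ}
    (hM : ∀ x, |f x| ≤ M / √(frontDenom ν x)) : MemLp f 2 (volume : Measure ℝ) := by
  rw [memLp_two_iff_integrable_sq hf.aestronglyMeasurable]
  have hc : 0 < √ν := Real.sqrt_pos.mpr hν
  refine (integrable_inv_one_add_sq.const_mul (M ^ 2 * (√ν)⁻¹)).mono'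
    (hf.pow 2).aestronglyMeasurable (Eventually.of_forall fun x => ?_)
  have h1 : 0 < √ν * (1 + x ^ 2) := by positivity
  rw [Real.norm_of_nonneg (sq_nonneg _), ← sq_abs]
  calc |f x| ^ 2 ≤ (M / √(frontDenom ν x)) ^ 2 := by gcongr; exact hM x
    _ = M ^ 2 / frontDenom ν x := by rw [div_pow, sq_sqrt_frontDenom]
    _ ≤ M ^ 2 / (√ν * (1 + x ^ 2)) := by gcongr; exact le_frontDenom ν x
    _ = _ := by field_simp

theorem memLp_evenMode {ν : ℝ} (hν : 0 < ν) : MemLp (evenMode ν) 2 (volume : Measure ℝ) :=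
  memLp_two_of_abs_le hν (continuous_evenMode ν) (abs_evenMode_le hν)

theorem memLp_oddMode {ν : ℝ} (hν : 0 < ν) : MemLp (oddMode ν) 2 (volume : Measure ℝ) :=
  memLp_two_of_abs_le hν (continuous_oddMode ν) (abs_oddMode_le hν)

theorem tendsto_evenMode {ν : ℝ} (hν : 0 < ν) : Tendsto (evenMode ν) atTop (𝓝 0) := by
  have hc : 0 < √ν := Real.sqrt_pos.mpr hν
  have h1 : Tendsto (frontDenom ν) atTop atTop := by
    refine tendsto_atTop_mono (le_frontDenom ν) (Tendsto.const_mul_atTop hc ?_)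
    exact tendsto_atTop_add_const_left _ 1 (tendsto_pow_atTop two_ne_zero)
  have h2 : Tendsto (fun x => (√ν)⁻¹ / √(frontDenom ν x)) atTop (𝓝 0) :=
    tendsto_const_nhds.div_atTop (Real.tendsto_sqrt_atTop.comp h1)
  exact squeeze_zero (fun x => (evenMode_pos ν x).le)
    (fun x => (le_abs_self _).trans (abs_evenMode_le hν x)) h2

theorem tendsto_oddMode {ν : ℝ} (hν : 0 < ν) : Tendsto (oddMode ν) atTop (𝓝 0) :=
  squeeze_zero_norm (fun x => abs_oddMode_le_evenMode ν x) (tendsto_evenMode hν)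

end Modes

end

end PulseLinearization

namespace PulseLinearization

noncomputable section

/-! ### A spectral gap on the half-line by factorization -/

section HalfLine

/-- `F` is only required to have limits 0 at the two ends, because the boundary expression used
later contains coefficients singular at 0. Integration therefore runs over `(a, b)`, with `b → ∞`
and then `a → 0`. -/
theorem integral_Ioi_nonneg_of_hasDerivAt_le {F F' φ : ℝ → ℝ}
    (hF : ∀ x > 0, HasDerivAt F (F' x) x) (hle : ∀ x > 0, F' x ≤ φ x)
    (hφ : IntegrableOn φ (Ioi 0)) (h0 : Tendsto F (𝓝[>] 0) (𝓝 0)) (htop : Tendsto F atTop (𝓝 0)) :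
    0 ≤ ∫ x in Ioi (0 : ℝ), φ x := by
  have h1 : ∀ a > 0, -F a ≤ ∫ x in Ioi a, φ x := by
    intro a ha
    have hφa : IntegrableOn φ (Ioi a) := hφ.mono_set (Ioi_subset_Ioi ha.le)
    have hlim := intervalIntegral_tendsto_integral_Ioi a hφa tendsto_id
    have hlim' : Tendsto (fun b => F b - F a) atTop (𝓝 (0 - F a)) := htop.sub_const _
    rw [zero_sub] at hlim'
    refine le_of_tendsto_of_tendsto hlim' hlim ?_
    filter_upwards [eventually_ge_atTop a] with b hb
    refine intervalIntegral.sub_le_integral_of_hasDeriv_right_of_le hb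
      (fun x hx => (hF x (ha.trans_le hx.1)).continuousAt.continuousWithinAt)
      (fun x hx => (hF x (ha.trans hx.1)).hasDerivWithinAt)
      (hφ.mono_set fun x hx => ha.trans_le hx.1) fun x hx => hle x (ha.trans hx.1)
  have hcov : AECover (volume.restrict (Ioi (0 : ℝ))) (𝓝[>] 0) fun a : ℝ => Ioi a :=
    aecover_Ioi_of_Ioi (tendsto_id.mono_left nhdsWithin_le_nhds)
  have h2 := hcov.integral_tendsto_of_countably_generated hφ
  have h3 : Tendsto (fun a => -F a) (𝓝[>] 0) (𝓝 0) := by simpa using h0.neg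
  refine le_of_tendsto_of_tendsto h3 h2 ?_
  filter_upwards [self_mem_nhdsWithin] with a ha
  rw [Measure.restrict_restrict measurableSet_Ioi, inter_eq_left.mpr (Ioi_subset_Ioi (le_of_lt ha))]
  exact h1 a ha

/-- A Poincaré inequality on the half-line by a double Riccati substitution: if `w'' = Q w`, then
`-d² + Q - 1` is nonnegative modulo `w` as soon as the partner potential `2 (w'/w)² - Q` exceeds
`1 + σ' + σ²`. -/
theorem halfLine_form_nonneg {w w' Q σ σ' u u' Ψ : ℝ → ℝ} {β : ℝ} (hw0 : ∀ x > 0, 0 < w x)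
    (hw : ∀ x > 0, HasDerivAt w (w' x) x) (hw' : ∀ x > 0, HasDerivAt w' (Q x * w x) x)
    (hσ : ∀ x > 0, HasDerivAt σ (σ' x) x) (hu : ∀ x > 0, HasDerivAt u (u' x) x)
    (hΨ : ∀ x > 0, HasDerivAt Ψ (w x * (u x - β * w x)) x)
    (hgap : ∀ x > 0, 1 ≤ 2 * (w' x / w x) ^ 2 - Q x - σ' x - σ x ^ 2)
    (hgt : Tendsto (fun x => w' x / w x) atTop (𝓝 (-1))) (hσt : Tendsto σ atTop (𝓝 0))
    (hut : Tendsto u atTop (𝓝 0)) (hwt : Tendsto w atTop (𝓝 0)) (hΨt : Tendsto Ψ atTop (𝓝 0))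
    (h0 : Tendsto (fun x => w' x / w x * u x ^ 2 - 2 * (u x - β * w x) * (Ψ x / w x) +
      (σ x + w' x / w x) * (Ψ x / w x) ^ 2) (𝓝[>] 0) (𝓝 0))
    (hint : IntegrableOn (fun x => u' x ^ 2 + Q x * u x ^ 2 - (u x - β * w x) ^ 2) (Ioi 0)) :
    0 ≤ ∫ x in Ioi (0 : ℝ), (u' x ^ 2 + Q x * u x ^ 2 - (u x - β * w x) ^ 2) := by
  have hht : Tendsto (fun x => u x - β * w x) atTop (𝓝 0) := by simpa using hut.sub (hwt.const_mul β)
  have hvt : Tendsto (fun x => Ψ x / w x) atTop (𝓝 0) := by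
    have hg0 : ∀ᶠ x in atTop, w' x / w x < -(1 / 2) :=
      hgt.eventually (gt_mem_nhds (by norm_num))
    -- `Ψ / w` is of type `0/0` at infinity, and the quotient of derivatives is `(u - βw) / (w'/w) →
    -- 0 / (-1)`.
    refine HasDerivAt.lhopital_zero_atTop (f' := fun x => w x * (u x - β * w x)) (g' := w') ?_ ?_ ?_
      hΨt hwt ?_
    · filter_upwards [eventually_gt_atTop 0] with x hx using hΨ x hx
    · filter_upwards [eventually_gt_atTop 0] with x hx using hw x hx
    · filter_upwards [hg0] with x hx h
      rw [h, zero_div] at hx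
      norm_num at hx
    · have : Tendsto (fun x => (u x - β * w x) / (w' x / w x)) atTop (𝓝 (0 / (-1))) :=
        hht.div hgt (by norm_num)
      rw [zero_div] at this
      refine this.congr fun x => ?_
      rw [div_div_eq_mul_div, mul_comm]
  -- Put `g = w'/w`, `h = u - βw`, `v = Ψ/w`, so that `v' + g v = h` and `u' - g u = h' - g h`. The
  -- first square, `(h' - g h + v)²`, comes from completing the square in the factored form, using
  -- `∫ h² = -∫ v (h' - g h)`. The second is `(v' - σ v)²`, the Riccati factorization of the partner
  -- operator `-d² + 2g² - Q` acting on `v`. `F` collects the boundary terms.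
  refine integral_Ioi_nonneg_of_hasDerivAt_le (F := fun x => w' x / w x * u x ^ 2 -
    2 * (u x - β * w x) * (Ψ x / w x) + (σ x + w' x / w x) * (Ψ x / w x) ^ 2)
    (F' := fun x => u' x ^ 2 + Q x * u x ^ 2 - (u x - β * w x) ^ 2 -
      ((u' x - w' x / w x * u x + Ψ x / w x) ^ 2 +
        (u x - β * w x - (w' x / w x + σ x) * (Ψ x / w x)) ^ 2 +
        (2 * (w' x / w x) ^ 2 - Q x - σ' x - σ x ^ 2 - 1) * (Ψ x / w x) ^ 2))
    (fun x hx => ?_) (fun x hx => ?_) hint h0 ?_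
  · have hwx := (hw0 x hx).ne'
    have hg := (hw' x hx).div (hw x hx) hwx
    have hv := (hΨ x hx).div (hw x hx) hwx
    have hh := (hu x hx).sub ((hw x hx).const_mul β)
    refine (((hg.mul ((hu x hx).pow 2)).sub ((hh.const_mul 2).mul hv)).add
      (((hσ x hx).add hg).mul (hv.pow 2))).congr_deriv ?_
    simp only [Pi.pow_apply, Pi.add_apply, Pi.sub_apply, Pi.div_apply]
    generalize w x = y at *
    push_cast
    field_simp
    ring
  · have := hgap x hx
    have h1 : 0 ≤ (2 * (w' x / w x) ^ 2 - Q x - σ' x - σ x ^ 2 - 1) * (Ψ x / w x) ^ 2 :=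
      mul_nonneg (by linarith) (sq_nonneg _)
    nlinarith [sq_nonneg (u' x - w' x / w x * u x + Ψ x / w x),
      sq_nonneg (u x - β * w x - (w' x / w x + σ x) * (Ψ x / w x))]
  · have := ((hgt.mul (hut.pow 2)).sub ((hht.const_mul 2).mul hvt)).add
      ((hσt.add hgt).mul (hvt.pow 2))
    simpa using this

end HalfLine

end

end PulseLinearization

namespace PulseLinearization

noncomputable section

/-! ### The half-line inequalities for the odd and the even mode -/

section ModeInequalities

/-- `β` is the projection coefficient of `u` on `w` in `L²(0, ∞)`; it makes `w (u - βw)` have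
integral 0, so its primitive from 0 vanishes at both ends. -/
theorem exists_primitive_tendsto_zero {w u : ℝ → ℝ} (hwc : Continuous w) (huc : Continuous u)
    (hw : MemLp w 2 (volume : Measure ℝ)) (hu : MemLp u 2 (volume : Measure ℝ))
    (hpos : ∀ x > 0, 0 < w x) :
    ∃ (β : ℝ) (Ψ : ℝ → ℝ), (∀ x, HasDerivAt Ψ (w x * (u x - β * w x)) x) ∧ Ψ 0 = 0 ∧
      Tendsto Ψ atTop (𝓝 0) := by
  have hwu : Integrable (fun x => w x * u x) volume := hw.integrable_mul hu
  have hww : Integrable (fun x => w x * w x) volume := hw.integrable_mul hw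
  set N := ∫ x in Ioi (0 : ℝ), w x * w x with hN
  have hNpos : 0 < N := by
    rw [hN, setIntegral_pos_iff_support_of_nonneg_ae
      (Eventually.of_forall fun x => mul_self_nonneg (w x)) hww.integrableOn]
    refine (by simp : (0 : ℝ≥0∞) < volume (Ioi (0 : ℝ))).trans_le (measure_mono fun x hx => ?_)
    exact ⟨(mul_pos (hpos x hx) (hpos x hx)).ne', hx⟩
  set β := (∫ x in Ioi (0 : ℝ), w x * u x) / N with hβ
  have hc : Continuous fun x => w x * (u x - β * w x) := by fun_prop
  have hint : Integrable (fun x => w x * (u x - β * w x)) volume := by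
    refine (hwu.sub (hww.const_mul β)).congr (Eventually.of_forall fun x => ?_)
    simp only [Pi.sub_apply]
    ring
  refine ⟨β, fun x => ∫ t in (0 : ℝ)..x, w t * (u t - β * w t), fun x => ?_, ?_, ?_⟩
  · exact intervalIntegral.integral_hasDerivAt_right (hc.intervalIntegrable _ _)
      (hc.stronglyMeasurableAtFilter _ _) hc.continuousAt
  · simp
  · have h := intervalIntegral_tendsto_integral_Ioi 0 hint.integrableOn tendsto_id
    have h0 : ∫ x in Ioi (0 : ℝ), w x * (u x - β * w x) = 0 := by
      have : ∀ x, w x * (u x - β * w x) = w x * u x - β * (w x * w x) := fun x => by ring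
      simp only [this]
      rw [integral_sub hwu.integrableOn (hww.integrableOn.const_mul β), integral_const_mul, ← hN,
        hβ, div_mul_cancel₀ _ hNpos.ne', sub_self]
    rwa [h0] at h

theorem tendsto_tanh_two_mul :
    Tendsto (fun x => Real.sinh (2 * x) / Real.cosh (2 * x)) atTop (𝓝 1) := by
  have h1 : Tendsto (fun x : ℝ => Real.exp (-(4 * x))) atTop (𝓝 0) :=
    Real.tendsto_exp_neg_atTop_nhds_zero.comp (tendsto_id.const_mul_atTop (by norm_num))
  have h2 : Tendsto (fun x : ℝ => (1 - Real.exp (-(4 * x))) / (1 + Real.exp (-(4 * x)))) atTop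
      (𝓝 ((1 - 0) / (1 + 0))) := (h1.const_sub 1).div (h1.const_add 1) (by norm_num)
  norm_num at h2
  refine h2.congr fun x => ?_
  rw [Real.sinh_eq, Real.cosh_eq]
  have h3 : Real.exp (-(2 * x)) = Real.exp (2 * x) * Real.exp (-(4 * x)) := by
    rw [← Real.exp_add]; ring_nf
  rw [h3]
  have h4 := Real.exp_pos (2 * x)
  have h5 := Real.exp_pos (-(4 * x))
  field_simp

theorem tendsto_inv_frontDenom {ν : ℝ} (hν : 0 < ν) :
    Tendsto (fun x => (frontDenom ν x)⁻¹) atTop (𝓝 0) := by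
  have hc : 0 < √ν := Real.sqrt_pos.mpr hν
  refine Tendsto.inv_tendsto_atTop
    (tendsto_atTop_mono (le_frontDenom ν) (Tendsto.const_mul_atTop hc ?_))
  exact tendsto_atTop_add_const_left _ 1 (tendsto_pow_atTop two_ne_zero)

theorem tendsto_frontSlope {ν : ℝ} (hν : 0 < ν) : Tendsto (frontSlope ν) atTop (𝓝 3) := by
  have h := (tendsto_tanh_two_mul.mul ((tendsto_inv_frontDenom hν).const_sub 1)).const_mul 3
  norm_num at h
  refine h.congr fun x => ?_
  have h1 := frontDenom_pos ν x
  have h2 := Real.cosh_pos (2 * x)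
  rw [frontSlope]
  field_simp
  unfold frontDenom
  ring

theorem evenModeDeriv_div (ν x : ℝ) : evenModeDeriv ν x / evenMode ν x =
    2 * (Real.sinh (2 * x) / Real.cosh (2 * x)) - frontSlope ν x := by
  have h1 := (evenMode_pos ν x).ne'
  rw [evenModeDeriv_eq, sub_div, mul_div_assoc, mul_div_cancel_right₀ _ h1, oddMode, evenMode,
    div_div_div_cancel_right₀ (pow_pos (sqrt_frontDenom_pos ν x) 3).ne']

theorem oddModeDeriv_div (ν : ℝ) {x : ℝ} (hx : 0 < x) : oddModeDeriv ν x / oddMode ν x =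
    2 * (Real.cosh (2 * x) / Real.sinh (2 * x)) - frontSlope ν x := by
  have h1 := (oddMode_pos ν hx).ne'
  rw [oddModeDeriv_eq, sub_div, mul_div_assoc, mul_div_cancel_right₀ _ h1, oddMode, evenMode,
    div_div_div_cancel_right₀ (pow_pos (sqrt_frontDenom_pos ν x) 3).ne']

/-- The partner potential is `1 + 8 / sinh² 2x + 3(1 - ν) / D²`, visibly at least 1, so `σ = 0`
suffices. -/
theorem oddMode_gap {ν : ℝ} (hν : ν ∈ Ioo (0 : ℝ) 1) {x : ℝ} (hx : 0 < x) :
    1 ≤ 2 * (oddModeDeriv ν x / oddMode ν x) ^ 2 - scaledPotential ν x := by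
  have hS : 0 < Real.sinh (2 * x) := Real.sinh_pos_iff.mpr (by linarith)
  have hD := frontDenom_pos ν x
  have hC := Real.cosh_sq (2 * x)
  have hc : √ν ^ 2 = ν := Real.sq_sqrt hν.1.le
  have key : 2 * (oddModeDeriv ν x / oddMode ν x) ^ 2 - scaledPotential ν x =
      1 + 8 / Real.sinh (2 * x) ^ 2 + 3 * (1 - ν) / frontDenom ν x ^ 2 := by
    rw [oddModeDeriv_div ν hx, scaledPotential, frontSlope]
    have hD' : frontDenom ν x = 1 + √ν * Real.cosh (2 * x) := rfl
    generalize frontDenom ν x = D at *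
    generalize √ν = c at *
    generalize Real.cosh (2 * x) = C at *
    generalize Real.sinh (2 * x) = S at *
    have hD0 : D ≠ 0 := hD.ne'
    have hS0 : S ≠ 0 := hS.ne'
    have f1 : (C / S) ^ 2 = 1 + 1 / S ^ 2 := by
      field_simp
      linear_combination hC
    have f2 : C / S * (3 * c * S / D) = 3 * (1 - 1 / D) := by
      field_simp
      linear_combination -hD'
    have f3 : (3 * c * S / D) ^ 2 = 9 * ((1 - 1 / D) ^ 2 - c ^ 2 * (1 / D) ^ 2) := by
      field_simp
      rw [hD']
      linear_combination -9 * c ^ 2 * hC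
    linear_combination 8 * f1 - 8 * f2 + 2 * f3 - 18 * (1 / D) ^ 2 * hc
  rw [key]
  have h1 : 0 ≤ 8 / Real.sinh (2 * x) ^ 2 := by positivity
  have h2 : 0 ≤ 3 * (1 - ν) / frontDenom ν x ^ 2 :=
    div_nonneg (by linarith [hν.2]) (by positivity)
  linarith

/-- Here the partner potential contains the well `-8 / cosh² 2x`. The equation `-f'' - 8 f / cosh²
2x = 0` has the solution `tanh 2x`, positive on the half-line, and `σ = 4 / sinh 4x` is its
logarithmic derivative; thus `σ' + σ²` cancels the well exactly. -/
theorem evenMode_gap {ν : ℝ} (hν : ν ∈ Ioo (0 : ℝ) 1) {x : ℝ} (hx : 0 < x) :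
    1 ≤ 2 * (evenModeDeriv ν x / evenMode ν x) ^ 2 - (scaledPotential ν x + excess ν x) -
      (-(4 * Real.cosh (4 * x) * 4) / Real.sinh (4 * x) ^ 2) - (4 / Real.sinh (4 * x)) ^ 2 := by
  have hS : 0 < Real.sinh (2 * x) := Real.sinh_pos_iff.mpr (by linarith)
  have hC0 : 0 < Real.cosh (2 * x) := Real.cosh_pos _
  have hD := frontDenom_pos ν x
  have hC := Real.cosh_sq (2 * x)
  have hc : √ν ^ 2 = ν := Real.sq_sqrt hν.1.le
  have h4 : 4 * x = 2 * (2 * x) := by ring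
  have key : 2 * (evenModeDeriv ν x / evenMode ν x) ^ 2 - (scaledPotential ν x + excess ν x) -
      (-(4 * Real.cosh (4 * x) * 4) / Real.sinh (4 * x) ^ 2) - (4 / Real.sinh (4 * x)) ^ 2 =
      1 + 3 * (1 - ν) / frontDenom ν x ^ 2 + excess ν x := by
    rw [evenModeDeriv_div ν x, scaledPotential, frontSlope, excess, h4,
      Real.cosh_two_mul (2 * x), Real.sinh_two_mul (2 * x)]
    have hD' : frontDenom ν x = 1 + √ν * Real.cosh (2 * x) := rfl
    generalize frontDenom ν x = D at *
    generalize √ν = c at *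
    generalize Real.cosh (2 * x) = C at *
    generalize Real.sinh (2 * x) = S at *
    have hD0 : D ≠ 0 := hD.ne'
    have hS0 : S ≠ 0 := hS.ne'
    have hC1 : C ≠ 0 := hC0.ne'
    have f1 : (S / C) ^ 2 = 1 - 1 / C ^ 2 := by
      field_simp
      linear_combination -hC
    have f2 : S / C * (3 * c * S / D) = 3 * (1 - 1 / D) - 3 * (c / (D * C)) := by
      field_simp
      rw [hD']
      linear_combination -c * hC
    have f3 : (3 * c * S / D) ^ 2 = 9 * ((1 - 1 / D) ^ 2 - c ^ 2 * (1 / D) ^ 2) := by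
      field_simp
      rw [hD']
      linear_combination -9 * c ^ 2 * hC
    have f4 : -(-(4 * (C ^ 2 + S ^ 2) * 4) / (2 * S * C) ^ 2) - (4 / (2 * S * C)) ^ 2 =
        8 / C ^ 2 := by
      field_simp
      linear_combination 16 * hC
    linear_combination 8 * f1 - 8 * f2 + 2 * f3 + f4 - 18 * (1 / D) ^ 2 * hc
  rw [key]
  have h1 := (excess_pos hν.1 x).le
  have h2 : 0 ≤ 3 * (1 - ν) / frontDenom ν x ^ 2 :=
    div_nonneg (by linarith [hν.2]) (by positivity)
  linarith

variable {ν : ℝ} {u u' : ℝ → ℝ}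

theorem integrable_form (hu : MemLp u 2 (volume : Measure ℝ))
    (hu' : MemLp u' 2 (volume : Measure ℝ)) {Q : ℝ → ℝ} (hQ : Continuous Q) {M : ℝ}
    (hQM : ∀ x, |Q x| ≤ M) {k : ℝ → ℝ} (hk : MemLp k 2 (volume : Measure ℝ)) :
    Integrable (fun x => u' x ^ 2 + Q x * u x ^ 2 - k x ^ 2) volume :=
  (hu'.integrable_sq.add (hu.integrable_sq.bdd_mul hQ.aestronglyMeasurable
    (Eventually.of_forall hQM))).sub hk.integrable_sq

theorem oddMode_form_nonneg (hν : ν ∈ Ioo (0 : ℝ) 1) (hu : ∀ x, HasDerivAt u (u' x) x)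
    (hu'c : Continuous u') (huL : MemLp u 2 (volume : Measure ℝ))
    (hu'L : MemLp u' 2 (volume : Measure ℝ)) (hut : Tendsto u atTop (𝓝 0)) (hu0 : u 0 = 0) :
    ∃ β, 0 ≤ ∫ x in Ioi (0 : ℝ),
      (u' x ^ 2 + scaledPotential ν x * u x ^ 2 - (u x - β * oddMode ν x) ^ 2) := by
  have huc : Continuous u := continuous_iff_continuousAt.mpr fun x => (hu x).continuousAt
  have hwc := continuous_oddMode ν
  have hw'c : Continuous (oddModeDeriv ν) :=
    continuous_iff_continuousAt.mpr fun x => (hasDerivAt_oddModeDeriv hν.1.le x).continuousAt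
  obtain ⟨β, Ψ, hΨ, hΨ0, hΨt⟩ := exists_primitive_tendsto_zero hwc huc (memLp_oddMode hν.1) huL
    fun x hx => oddMode_pos ν hx
  have hΨc : Continuous Ψ := continuous_iff_continuousAt.mpr fun x => (hΨ x).continuousAt
  have hw0 : oddMode ν 0 = 0 := by simp [oddMode]
  have hw'0 : oddModeDeriv ν 0 ≠ 0 := by
    have := sqrt_frontDenom_pos ν 0
    simp [oddModeDeriv, this.ne']
  have lim : ∀ {f : ℝ → ℝ}, Continuous f → ∀ {y}, f 0 = y → Tendsto f (𝓝[>] 0) (𝓝 y) :=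
    fun {f} hf {y} h => h ▸ (hf.tendsto 0).mono_left nhdsWithin_le_nhds
  have hw'ne : ∀ᶠ x in 𝓝[>] (0 : ℝ), oddModeDeriv ν x ≠ 0 :=
    (lim hw'c rfl).eventually_ne hw'0
  have hwne : ∀ᶠ x in 𝓝[>] (0 : ℝ), oddMode ν x ≠ 0 := by
    filter_upwards [self_mem_nhdsWithin] with x hx using (oddMode_pos ν hx).ne'
  have l1 : Tendsto (fun x => u x / oddMode ν x) (𝓝[>] 0) (𝓝 (u' 0 / oddModeDeriv ν 0)) :=
    HasDerivAt.lhopital_zero_nhdsGT (Eventually.of_forall fun x => hu x)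
      (Eventually.of_forall (hasDerivAt_oddMode ν)) hw'ne (lim huc hu0) (lim hwc hw0)
      ((lim hu'c rfl).div (lim hw'c rfl) hw'0)
  have hhc : Continuous fun x => u x - β * oddMode ν x := by fun_prop
  have l2 : Tendsto (fun x => Ψ x / oddMode ν x) (𝓝[>] 0) (𝓝 (0 / oddModeDeriv ν 0)) :=
    HasDerivAt.lhopital_zero_nhdsGT (Eventually.of_forall hΨ)
      (Eventually.of_forall (hasDerivAt_oddMode ν)) hw'ne (lim hΨc hΨ0) (lim hwc hw0)
      ((lim (hwc.mul hhc) (by simp [hw0])).div (lim hw'c rfl) hw'0)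
  -- Near 0, `w'/w` blows up like `1/x`. The boundary term `(w'/w) (Ψ/w)²` is regrouped as `w' ·
  -- (Ψ/w) · (Ψ/w²)`, and `(w'/w) u²` as `w' · u · (u/w)`, so that every factor has a limit.
  have l3 : Tendsto (fun x => Ψ x / oddMode ν x ^ 2) (𝓝[>] 0)
      (𝓝 (0 / (2 * oddModeDeriv ν 0))) := by
    refine HasDerivAt.lhopital_zero_nhdsGT (Eventually.of_forall hΨ)
      (Eventually.of_forall fun x => (hasDerivAt_oddMode ν x).pow 2) ?_ (lim hΨc hΨ0)
      (lim (hwc.pow 2) (by simp [hw0])) ?_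
    · filter_upwards [hw'ne, hwne] with x h1 h2
      simp [h1, h2]
    · refine ((lim hhc (by simp [hw0, hu0])).div ((lim hw'c rfl).const_mul 2)
        (mul_ne_zero two_ne_zero hw'0)).congr' ?_
      filter_upwards [hw'ne, hwne] with x h1 h2
      simp only [Pi.div_apply]
      norm_num
      field_simp
  refine ⟨β, halfLine_form_nonneg (σ := fun _ => 0) (σ' := fun _ => 0)
    (fun x hx => oddMode_pos ν hx) (fun x _ => hasDerivAt_oddMode ν x)
    (fun x _ => hasDerivAt_oddModeDeriv hν.1.le x) (fun x _ => hasDerivAt_const x 0)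
    (fun x _ => hu x) (fun x _ => hΨ x) (fun x hx => ?_) ?_ tendsto_const_nhds hut
    (tendsto_oddMode hν.1) hΨt ?_ ?_⟩
  · simpa using oddMode_gap hν hx
  · have h1 := (tendsto_tanh_two_mul.inv₀ one_ne_zero).const_mul 2 |>.sub (tendsto_frontSlope hν.1)
    norm_num at h1
    refine h1.congr' ?_
    filter_upwards [eventually_gt_atTop 0] with x hx
    rw [oddModeDeriv_div ν hx]
  · have h1 := ((((lim hw'c rfl).mul (lim huc hu0)).mul l1).sub
      (((lim hhc (y := 0) (by simp [hw0, hu0])).const_mul 2).mul l2)).add (((lim hw'c rfl).mul l2).mul l3)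
    simp only [mul_zero, zero_mul, zero_div, sub_zero, add_zero] at h1
    refine h1.congr' ?_
    filter_upwards [hwne] with x hx
    field_simp
    ring
  · exact (integrable_form huL hu'L (continuous_scaledPotential ν) (abs_scaledPotential_le hν)
      (huL.sub ((memLp_oddMode hν.1).const_mul β))).integrableOn

theorem evenMode_form_nonneg (hν : ν ∈ Ioo (0 : ℝ) 1) (hu : ∀ x, HasDerivAt u (u' x) x)
    (huL : MemLp u 2 (volume : Measure ℝ))
    (hu'L : MemLp u' 2 (volume : Measure ℝ)) (hut : Tendsto u atTop (𝓝 0)) :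
    ∃ β, 0 ≤ ∫ x in Ioi (0 : ℝ), (u' x ^ 2 + (scaledPotential ν x + excess ν x) * u x ^ 2 -
      (u x - β * evenMode ν x) ^ 2) := by
  have huc : Continuous u := continuous_iff_continuousAt.mpr fun x => (hu x).continuousAt
  have hwc := continuous_evenMode ν
  have hw'c : Continuous (evenModeDeriv ν) :=
    continuous_iff_continuousAt.mpr fun x => (hasDerivAt_evenModeDeriv hν.1.le x).continuousAt
  have hoc := continuous_oddMode ν
  have ho'c : Continuous (oddModeDeriv ν) :=
    continuous_iff_continuousAt.mpr fun x => (hasDerivAt_oddModeDeriv hν.1.le x).continuousAt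
  obtain ⟨β, Ψ, hΨ, hΨ0, hΨt⟩ := exists_primitive_tendsto_zero hwc huc (memLp_evenMode hν.1) huL
    fun x _ => evenMode_pos ν x
  have hΨc : Continuous Ψ := continuous_iff_continuousAt.mpr fun x => (hΨ x).continuousAt
  have hwne : ∀ x, evenMode ν x ≠ 0 := fun x => (evenMode_pos ν x).ne'
  have hw'0 : evenModeDeriv ν 0 = 0 := by simp [evenModeDeriv]
  have ho0 : oddMode ν 0 = 0 := by simp [oddMode]
  have ho'0 : oddModeDeriv ν 0 ≠ 0 := by
    have := sqrt_frontDenom_pos ν 0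
    simp [oddModeDeriv, this.ne']
  have lim : ∀ {f : ℝ → ℝ}, Continuous f → ∀ {y}, f 0 = y → Tendsto f (𝓝[>] 0) (𝓝 y) :=
    fun {f} hf {y} h => h ▸ (hf.tendsto 0).mono_left nhdsWithin_le_nhds
  have hhc : Continuous fun x => u x - β * evenMode ν x := by fun_prop
  have hgc : Continuous fun x => evenModeDeriv ν x / evenMode ν x := hw'c.div hwc hwne
  have hvc : Continuous fun x => Ψ x / evenMode ν x := hΨc.div hwc hwne
  have l2 : Tendsto (fun x => Ψ x / oddMode ν x) (𝓝[>] 0)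
      (𝓝 (evenMode ν 0 * (u 0 - β * evenMode ν 0) / oddModeDeriv ν 0)) :=
    HasDerivAt.lhopital_zero_nhdsGT (Eventually.of_forall hΨ)
      (Eventually.of_forall (hasDerivAt_oddMode ν)) ((lim ho'c rfl).eventually_ne ho'0)
      (lim hΨc hΨ0) (lim hoc ho0) ((lim (hwc.mul hhc) rfl).div (lim ho'c rfl) ho'0)
  refine ⟨β, halfLine_form_nonneg (σ := fun x => 4 / Real.sinh (4 * x))
    (σ' := fun x => -(4 * Real.cosh (4 * x) * 4) / Real.sinh (4 * x) ^ 2)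
    (fun x _ => evenMode_pos ν x) (fun x _ => hasDerivAt_evenMode ν x)
    (fun x _ => hasDerivAt_evenModeDeriv hν.1.le x) (fun x hx => ?_)
    (fun x _ => hu x) (fun x _ => hΨ x) (fun x hx => evenMode_gap hν hx) ?_ ?_ hut
    (tendsto_evenMode hν.1) hΨt ?_ ?_⟩
  · have hS : Real.sinh (4 * x) ≠ 0 := (Real.sinh_pos_iff.mpr (by linarith)).ne'
    have h1 : HasDerivAt (fun y : ℝ => 4 * y) 4 x := by
      simpa using (hasDerivAt_id x).const_mul (4 : ℝ)
    refine ((hasDerivAt_const x (4 : ℝ)).div ((Real.hasDerivAt_sinh (4 * x)).comp x h1)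
      hS).congr_deriv ?_
    simp only [Function.comp_apply]
    ring
  · have h1 := (tendsto_tanh_two_mul.const_mul 2).sub (tendsto_frontSlope hν.1)
    norm_num at h1
    exact h1.congr fun x => (evenModeDeriv_div ν x).symm
  · refine tendsto_const_nhds.div_atTop (tendsto_atTop_mono' _ ?_ tendsto_id)
    filter_upwards [eventually_ge_atTop 0] with x hx
    have : 4 * x ≤ Real.sinh (4 * x) := Real.self_le_sinh_iff.mpr (by linarith)
    simp only [id]
    linarith
  · have h1 : Tendsto (fun x => evenModeDeriv ν x / evenMode ν x * u x ^ 2 -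
        2 * (u x - β * evenMode ν x) * (Ψ x / evenMode ν x) +
        (evenModeDeriv ν x / evenMode ν x * (Ψ x / evenMode ν x) ^ 2)) (𝓝[>] 0) (𝓝 0) :=
      lim (by fun_prop) (by simp [hw'0, hΨ0])
    -- This is the singular term `σ (Ψ/w)²`, rewritten with `σ = 2 coth 2x - 2 tanh 2x`; the pole of
    -- `coth` is absorbed in `Ψ / oddMode`, which has a limit because `Ψ 0 = 0`.
    have h2 : Tendsto (fun x => 2 * (Ψ x / oddMode ν x) * (Ψ x / evenMode ν x) -
        2 * (oddMode ν x / evenMode ν x) * (Ψ x / evenMode ν x) ^ 2) (𝓝[>] 0) (𝓝 0) := by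
      have h3 := ((l2.const_mul 2).mul (lim hvc (y := 0) (by simp [hΨ0]))).sub
        (lim (((hoc.div hwc hwne).const_mul 2).mul (hvc.pow 2)) (y := 0) (by simp [hΨ0]))
      simpa using h3
    have h4 := h1.add h2
    rw [add_zero] at h4
    refine h4.congr' ?_
    filter_upwards [self_mem_nhdsWithin] with x hx
    have hS : 0 < Real.sinh (2 * x) := Real.sinh_pos_iff.mpr (by linarith [mem_Ioi.mp hx])
    have hC := Real.cosh_pos (2 * x)
    have hC2 := Real.cosh_sq (2 * x)
    have hs := sqrt_frontDenom_pos ν x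
    have e1 : oddMode ν x = evenMode ν x * (Real.sinh (2 * x) / Real.cosh (2 * x)) := by
      rw [oddMode, evenMode]
      field_simp
    have e2 : 4 / Real.sinh (4 * x) = 2 * (Real.cosh (2 * x) / Real.sinh (2 * x)) -
        2 * (Real.sinh (2 * x) / Real.cosh (2 * x)) := by
      rw [show 4 * x = 2 * (2 * x) by ring, Real.sinh_two_mul]
      field_simp
      linear_combination -4 * hC2
    have h5 := hwne x
    rw [e1, e2]
    field_simp
    ring
  · refine (integrable_form (M := 28 + 12 * √ν) huL hu'L
      ((continuous_scaledPotential ν).add (continuous_excess ν)) (fun x => ?_)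
      (huL.sub ((memLp_evenMode hν.1).const_mul β))).integrableOn
    refine (abs_add_le _ _).trans (add_le_add (abs_scaledPotential_le hν x) ?_)
    rw [abs_of_pos (excess_pos hν.1 x)]
    exact excess_le ν x

end ModeInequalities

end

end PulseLinearization

namespace PulseLinearization

noncomputable section

/-! ### From the half-line to the whole line by parity -/

section WholeLine

theorem integral_Ioi_add_comp_neg {S : ℝ → ℝ} (hS : Integrable S volume) :
    ∫ x in Ioi (0 : ℝ), (S x + S (-x)) = ∫ x, S x := by
  have h1 : IntegrableOn (fun x => S (-x)) (Ioi 0) := hS.comp_neg.integrableOn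
  rw [integral_add hS.integrableOn h1, integral_comp_neg_Ioi, neg_zero, add_comm,
    intervalIntegral.integral_Iic_add_Ioi hS.integrableOn hS.integrableOn]

theorem memLp_comp_neg {f : ℝ → ℝ} (hf : MemLp f 2 (volume : Measure ℝ)) :
    MemLp (fun x => f (-x)) 2 (volume : Measure ℝ) :=
  hf.comp_measurePreserving (Measure.measurePreserving_neg volume)

/-- The form of the linearized operator controls the distance to the span of the two modes. -/
theorem exists_integral_sq_sub_modes_le {ν : ℝ} (hν : ν ∈ Ioo (0 : ℝ) 1) {u u' u'' : ℝ → ℝ}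
    (hu : ∀ x, HasDerivAt u (u' x) x) (hu' : ∀ x, HasDerivAt u' (u'' x) x)
    (huL : MemLp u 2 (volume : Measure ℝ)) (hu'L : MemLp u' 2 (volume : Measure ℝ))
    (hu''L : MemLp u'' 2 (volume : Measure ℝ)) (hut : Tendsto u (cocompact ℝ) (𝓝 0)) :
    ∃ β γ : ℝ, ∫ x, (u x - β * evenMode ν x - γ * oddMode ν x) ^ 2 ≤
      (∫ x, u x * (-u'' x + scaledPotential ν x * u x)) + 12 * √ν * ∫ x, u x ^ 2 := by
  have hu'c : Continuous u' := continuous_iff_continuousAt.mpr fun x => (hu' x).continuousAt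
  have hun : ∀ x, HasDerivAt (fun y => u (-y)) (-u' (-x)) x := fun x => by
    exact ((hu (-x)).comp x (hasDerivAt_neg x)).congr_deriv (by ring)
  have htop : Tendsto u atTop (𝓝 0) := hut.mono_left atTop_le_cocompact
  have hbot : Tendsto (fun x => u (-x)) atTop (𝓝 0) :=
    (hut.mono_left atBot_le_cocompact).comp tendsto_neg_atTop_atBot
  have heL := (huL.add (memLp_comp_neg huL)).const_mul (1 / 2)
  have heL' := (hu'L.sub (memLp_comp_neg hu'L)).const_mul (1 / 2)
  have hoL := (huL.sub (memLp_comp_neg huL)).const_mul (1 / 2)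
  have hoL' := (hu'L.add (memLp_comp_neg hu'L)).const_mul (1 / 2)
  obtain ⟨β, hβ⟩ := evenMode_form_nonneg hν
    (u := fun x => 1 / 2 * (u x + u (-x))) (u' := fun x => 1 / 2 * (u' x - u' (-x)))
    (fun x => ((hu x).add (hun x)).const_mul (1 / 2)) heL heL'
    (by have h := (htop.add hbot).const_mul (1 / 2 : ℝ); rwa [add_zero, mul_zero] at h)
  obtain ⟨γ, hγ⟩ := oddMode_form_nonneg hν
    (u := fun x => 1 / 2 * (u x - u (-x))) (u' := fun x => 1 / 2 * (u' x + u' (-x)))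
    (fun x => (((hu x).sub (hun x)).const_mul (1 / 2)).congr_deriv (by ring)) (by fun_prop)
    hoL hoL' (by have h := (htop.sub hbot).const_mul (1 / 2 : ℝ); rwa [sub_zero, mul_zero] at h)
    (by simp)
  refine ⟨β, γ, ?_⟩
  have hexb : ∀ x, |scaledPotential ν x + excess ν x| ≤ 28 + 12 * √ν := fun x => by
    refine (abs_add_le _ _).trans (add_le_add (abs_scaledPotential_le hν x) ?_)
    rw [abs_of_pos (excess_pos hν.1 x)]
    exact excess_le ν x
  have hkL : MemLp (fun x => u x - β * evenMode ν x - γ * oddMode ν x) 2 (volume : Measure ℝ) :=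
    (huL.sub ((memLp_evenMode hν.1).const_mul β)).sub ((memLp_oddMode hν.1).const_mul γ)
  set S : ℝ → ℝ := fun x => u' x ^ 2 + (scaledPotential ν x + 12 * √ν) * u x ^ 2 -
    (u x - β * evenMode ν x - γ * oddMode ν x) ^ 2 with hSdef
  have hSi : Integrable S volume := integrable_form (M := 28 + 12 * √ν) huL hu'L
    ((continuous_scaledPotential ν).add continuous_const) (fun x => by
      refine (abs_add_le _ _).trans (add_le_add (abs_scaledPotential_le hν x) ?_)
      rw [abs_of_nonneg (by positivity)]) hkL
  have hEi : IntegrableOn (fun x => (1 / 2 * (u' x - u' (-x))) ^ 2 +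
      (scaledPotential ν x + excess ν x) * (1 / 2 * (u x + u (-x))) ^ 2 -
        (1 / 2 * (u x + u (-x)) - β * evenMode ν x) ^ 2) (Ioi 0) volume := (integrable_form heL heL' ((continuous_scaledPotential ν).add (continuous_excess ν))
    hexb (heL.sub ((memLp_evenMode hν.1).const_mul β))).integrableOn (s := Ioi 0)
  have hOi : IntegrableOn (fun x => (1 / 2 * (u' x + u' (-x))) ^ 2 +
      scaledPotential ν x * (1 / 2 * (u x - u (-x))) ^ 2 -
        (1 / 2 * (u x - u (-x)) - γ * oddMode ν x) ^ 2) (Ioi 0) volume := (integrable_form hoL hoL' (continuous_scaledPotential ν) (abs_scaledPotential_le hν)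
    (hoL.sub ((memLp_oddMode hν.1).const_mul γ))).integrableOn (s := Ioi 0)
  have hD : ∀ x, frontDenom ν (-x) = frontDenom ν x := fun x => by simp [frontDenom]
  have hW : ∀ x, scaledPotential ν (-x) = scaledPotential ν x := fun x => by
    simp [scaledPotential, hD]
  have he : ∀ x, evenMode ν (-x) = evenMode ν x := fun x => by simp [evenMode, hD]
  have ho : ∀ x, oddMode ν (-x) = -oddMode ν x := fun x => by simp [oddMode, hD, neg_div]
  have hS0 : 0 ≤ ∫ x, S x := by
    have h1 := add_nonneg hβ hγ
    rw [← integral_add hEi hOi] at h1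
    -- In the even part of `S` the cross terms between the parities of `u` cancel. What remains
    -- dominates the sum of the even and odd integrands, because `12 √ν` replaces the smaller excess
    -- in the even sector and 0 in the odd one.
    have h2 : 0 ≤ ∫ x in Ioi (0 : ℝ), 1 / 2 * (S x + S (-x)) := by
      refine h1.trans (integral_mono (hEi.add hOi)
        ((hSi.add hSi.comp_neg).const_mul (1 / 2)).integrableOn fun x => ?_)
      have h3 := excess_le ν x
      simp only [hSdef, hW, he, ho]
      nlinarith [mul_nonneg (sub_nonneg.mpr h3) (sq_nonneg (1 / 2 * (u x + u (-x)))),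
        mul_nonneg (mul_nonneg (by norm_num : (0 : ℝ) ≤ 12) (Real.sqrt_nonneg ν))
          (sq_nonneg (1 / 2 * (u x - u (-x))))]
    rw [integral_const_mul, integral_Ioi_add_comp_neg hSi] at h2
    linarith
  have hibp : ∫ x, u x * u'' x = -∫ x, u' x * u' x :=
    integral_mul_deriv_eq_deriv_mul_of_integrable (fun x _ => hu x) (fun x _ => hu' x)
      (huL.integrable_mul hu''L) (hu'L.integrable_mul hu'L) (huL.integrable_mul hu'L)
  have hWu : Integrable (fun x => scaledPotential ν x * u x ^ 2) volume :=
    huL.integrable_sq.bdd_mul (continuous_scaledPotential ν).aestronglyMeasurable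
      (Eventually.of_forall (abs_scaledPotential_le hν))
  have hsplit : ∫ x, S x = (∫ x, u' x * u' x) + (∫ x, scaledPotential ν x * u x ^ 2) +
      12 * √ν * (∫ x, u x ^ 2) - ∫ x, (u x - β * evenMode ν x - γ * oddMode ν x) ^ 2 := by
    have h1 : ∀ x, S x = u' x * u' x + scaledPotential ν x * u x ^ 2 + 12 * √ν * u x ^ 2 -
        (u x - β * evenMode ν x - γ * oddMode ν x) ^ 2 := fun x => by simp only [hSdef]; ring
    have i1 : Integrable (fun x => u' x * u' x) volume := hu'L.integrable_mul hu'L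
    have i2 := huL.integrable_sq.const_mul (12 * √ν)
    have i3 : Integrable (fun x => u' x * u' x + scaledPotential ν x * u x ^ 2) volume :=
      i1.add hWu
    have i4 : Integrable (fun x => u' x * u' x + scaledPotential ν x * u x ^ 2 +
        12 * √ν * u x ^ 2) volume := i3.add i2
    simp only [h1]
    rw [integral_sub i4 hkL.integrable_sq, integral_add i3 i2,
      integral_add i1 hWu, integral_const_mul]
  have hq : ∫ x, u x * (-u'' x + scaledPotential ν x * u x) =
      (∫ x, u' x * u' x) + ∫ x, scaledPotential ν x * u x ^ 2 := by
    have h1 : ∀ x, u x * (-u'' x + scaledPotential ν x * u x) =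
        scaledPotential ν x * u x ^ 2 - u x * u'' x := fun x => by ring
    have i : Integrable (fun x => u x * u'' x) volume := huL.integrable_mul hu''L
    simp only [h1]
    rw [integral_sub hWu i, hibp]
    ring
  rw [hq]
  linarith

end WholeLine

/-! ### Form bounds for the linearized operator on `H²(ℝ)` and its spectrum -/

section Form

variable {ν : ℝ}

theorem re_inner_eq_integral (u v : L2) {f g : ℝ → ℂ} (hf : u =ᵐ[volume] f) (hg : v =ᵐ[volume] g) :
    (inner ℂ u v).re = ∫ x, (f x).re * (g x).re + (f x).im * (g x).im := by
  rw [L2.inner_def, ← RCLike.re_to_complex, ← integral_re (L2.integrable_inner u v)]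
  refine integral_congr_ae ?_
  filter_upwards [hf, hg] with x h1 h2
  rw [h1, h2]
  simp [mul_comm]

theorem norm_sq_eq_integral (u : L2) {f : ℝ → ℂ} (h : u =ᵐ[volume] f) :
    ‖u‖ ^ 2 = ∫ x, (f x).re ^ 2 + (f x).im ^ 2 := by
  have h1 := re_inner_eq_integral u u h h
  rw [← RCLike.re_to_complex, inner_self_eq_norm_sq] at h1
  simpa only [sq] using h1

/-- The class of `evenMode` in `L²`. -/
def evenVec (hν : 0 < ν) : L2 := (memLp_evenMode hν).ofReal.toLp _

/-- The class of `oddMode` in `L²`. -/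
def oddVec (hν : 0 < ν) : L2 := (memLp_oddMode hν).ofReal.toLp _

theorem evenVec_ae (hν : 0 < ν) : evenVec hν =ᵐ[volume] fun x => (evenMode ν x : ℂ) :=
  MemLp.coeFn_toLp _

theorem oddVec_ae (hν : 0 < ν) : oddVec hν =ᵐ[volume] fun x => (oddMode ν x : ℂ) :=
  MemLp.coeFn_toLp _

/-- The span of the two modes. -/
def modeSpan (hν : 0 < ν) : Submodule ℂ L2 := Submodule.span ℂ {evenVec hν, oddVec hν}

/-- The mode coefficients are found separately for each function, with no continuity in `u`. The
distance to the span is continuous, so in this form the estimate passes from Schwartz functions to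
`H²(ℝ)`. Real and imaginary parts are treated separately, as `W` is real. -/
theorem form_ge_infDist_sq (hν : ν ∈ Ioo (0 : ℝ) 1) {r : ℝ → ℝ} (hr : IsPulse ν r) (u : H2) :
    mass ν * Metric.infDist (u : L2) (modeSpan hν.1) ^ 2 ≤
      (inner ℂ (u : L2) (linearized hr u)).re + 12 * √ν * mass ν * ‖(u : L2)‖ ^ 2 := by
  have hm : 0 < mass ν := by unfold mass; linarith [hν.2]
  have hcont : Continuous fun p : L2 × L2 =>
      (inner ℂ p.1 (-(mass ν : ℂ) • p.2 + mulCLM hr.potential_memLp p.1)).re +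
        12 * √ν * mass ν * ‖p.1‖ ^ 2 - mass ν * Metric.infDist p.1 (modeSpan hν.1) ^ 2 := by
    have h1 : Continuous fun p : L2 × L2 => -(mass ν : ℂ) • p.2 :=
      continuous_snd.const_smul (-(mass ν : ℂ))
    have h2 : Continuous fun p : L2 × L2 => mulCLM hr.potential_memLp p.1 :=
      (mulCLM hr.potential_memLp).continuous.comp continuous_fst
    have h3 : Continuous fun p : L2 × L2 => Metric.infDist p.1 (modeSpan hν.1 : Set L2) :=
      (Metric.continuous_infDist_pt _).comp continuous_fst
    exact ((Complex.continuous_re.comp (continuous_fst.inner (h1.add h2))).add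
      (continuous_const.mul (continuous_fst.norm.pow 2))).sub (continuous_const.mul (h3.pow 2))
  have key := nonneg_of_schwartz (Φ := fun a b =>
    (inner ℂ a (-(mass ν : ℂ) • b + mulCLM hr.potential_memLp a)).re +
        12 * √ν * mass ν * ‖a‖ ^ 2 - mass ν * Metric.infDist a (modeSpan hν.1) ^ 2) hcont ?_ u
  · have h1 : (linearized hr u : L2) = -(mass ν : ℂ) • secondDeriv u +
      mulCLM hr.potential_memLp (u : L2) := rfl
    rw [h1]
    linarith
  intro k
  set k₁ := SchwartzMap.derivCLM ℂ ℂ k with hk₁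
  set k₂ := SchwartzMap.derivCLM ℂ ℂ k₁ with hk₂
  set a : L2 := k.toLp 2 with ha
  set b : L2 := k₂.toLp 2 with hb
  have haE : a =ᵐ[volume] k := k.coeFn_toLp 2 volume
  have hbE : b =ᵐ[volume] k₂ := k₂.coeFn_toLp 2 volume
  have hre : ∀ x, HasDerivAt (fun y => (k y).re) (k₁ x).re x := fun x => by
    exact (Complex.reCLM.hasFDerivAt.comp_hasDerivAt x (k.hasDerivAt x))
  have hre' : ∀ x, HasDerivAt (fun y => (k₁ y).re) (k₂ x).re x := fun x => by
    exact (Complex.reCLM.hasFDerivAt.comp_hasDerivAt x (k₁.hasDerivAt x))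
  have him : ∀ x, HasDerivAt (fun y => (k y).im) (k₁ x).im x := fun x => by
    exact (Complex.imCLM.hasFDerivAt.comp_hasDerivAt x (k.hasDerivAt x))
  have him' : ∀ x, HasDerivAt (fun y => (k₁ y).im) (k₂ x).im x := fun x => by
    exact (Complex.imCLM.hasFDerivAt.comp_hasDerivAt x (k₁.hasDerivAt x))
  have hLre : ∀ f : 𝓢(ℝ, ℂ), MemLp (fun x => (f x).re) 2 (volume : Measure ℝ) := fun f =>
    (f.memLp 2 volume).re
  have hLim : ∀ f : 𝓢(ℝ, ℂ), MemLp (fun x => (f x).im) 2 (volume : Measure ℝ) := fun f =>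
    (f.memLp 2 volume).im
  have hz : Tendsto k (cocompact ℝ) (𝓝 0) := k.toZeroAtInfty.zero_at_infty'
  have hzre : Tendsto (fun x => (k x).re) (cocompact ℝ) (𝓝 0) :=
    (Complex.continuous_re.tendsto' 0 0 rfl).comp hz
  have hzim : Tendsto (fun x => (k x).im) (cocompact ℝ) (𝓝 0) :=
    (Complex.continuous_im.tendsto' 0 0 rfl).comp hz
  obtain ⟨β₁, γ₁, h₁⟩ := exists_integral_sq_sub_modes_le hν hre hre' (hLre k) (hLre k₁) (hLre k₂)
    hzre
  obtain ⟨β₂, γ₂, h₂⟩ := exists_integral_sq_sub_modes_le hν him him' (hLim k) (hLim k₁) (hLim k₂)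
    hzim
  have hdist : Metric.infDist a (modeSpan hν.1) ^ 2 ≤
      (∫ x, ((k x).re - β₁ * evenMode ν x - γ₁ * oddMode ν x) ^ 2) +
        ∫ x, ((k x).im - β₂ * evenMode ν x - γ₂ * oddMode ν x) ^ 2 := by
    set y : L2 := (⟨β₁, β₂⟩ : ℂ) • evenVec hν.1 + (⟨γ₁, γ₂⟩ : ℂ) • oddVec hν.1 with hy
    have hymem : y ∈ modeSpan hν.1 :=
      Submodule.add_mem _ (Submodule.smul_mem _ _ (Submodule.subset_span (by simp)))
        (Submodule.smul_mem _ _ (Submodule.subset_span (by simp)))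
    have hle : Metric.infDist a (modeSpan hν.1) ≤ ‖a - y‖ := by
      rw [← dist_eq_norm]
      exact Metric.infDist_le_dist_of_mem hymem
    have hae : (a - y : L2) =ᵐ[volume] fun x =>
        k x - ((⟨β₁, β₂⟩ : ℂ) * evenMode ν x + (⟨γ₁, γ₂⟩ : ℂ) * oddMode ν x) := by
      filter_upwards [Lp.coeFn_sub a y, haE, Lp.coeFn_add ((⟨β₁, β₂⟩ : ℂ) • evenVec hν.1)
        ((⟨γ₁, γ₂⟩ : ℂ) • oddVec hν.1), Lp.coeFn_smul (⟨β₁, β₂⟩ : ℂ) (evenVec hν.1),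
        Lp.coeFn_smul (⟨γ₁, γ₂⟩ : ℂ) (oddVec hν.1), evenVec_ae hν.1, oddVec_ae hν.1]
        with x e1 e2 e3 e4 e5 e6 e7
      rw [e1, Pi.sub_apply, e2, hy, e3, Pi.add_apply, e4, e5, Pi.smul_apply, Pi.smul_apply, e6, e7,
        smul_eq_mul, smul_eq_mul]
    refine (pow_le_pow_left₀ Metric.infDist_nonneg hle 2).trans_eq ?_
    rw [norm_sq_eq_integral _ hae, ← integral_add]
    · refine integral_congr_ae (Eventually.of_forall fun x => ?_)
      simp
      ring
    · exact (((hLre k).sub ((memLp_evenMode hν.1).const_mul β₁)).sub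
        ((memLp_oddMode hν.1).const_mul γ₁)).integrable_sq
    · exact (((hLim k).sub ((memLp_evenMode hν.1).const_mul β₂)).sub
        ((memLp_oddMode hν.1).const_mul γ₂)).integrable_sq
  have hnorm : ‖a‖ ^ 2 = (∫ x, (k x).re ^ 2) + ∫ x, (k x).im ^ 2 := by
    rw [norm_sq_eq_integral _ haE, integral_add (hLre k).integrable_sq (hLim k).integrable_sq]
  have hinner : (inner ℂ a (-(mass ν : ℂ) • b + mulCLM hr.potential_memLp a)).re =
      mass ν * ((∫ x, (k x).re * (-(k₂ x).re + scaledPotential ν x * (k x).re)) +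
        ∫ x, (k x).im * (-(k₂ x).im + scaledPotential ν x * (k x).im)) := by
    have hae : (-(mass ν : ℂ) • b + mulCLM hr.potential_memLp a : L2) =ᵐ[volume] fun x =>
        (mass ν : ℂ) * (-k₂ x + scaledPotential ν x * k x) := by
      filter_upwards [Lp.coeFn_add (-(mass ν : ℂ) • b) (mulCLM hr.potential_memLp a),
        Lp.coeFn_smul (-(mass ν : ℂ)) b, mulOp_ae hr.potential_memLp a, haE, hbE]
        with x e1 e2 e3 e4 e5
      rw [e1, Pi.add_apply, e2, Pi.smul_apply, mulCLM_apply, e3, e4, e5, hr.potential_eq hν,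
        smul_eq_mul]
      push_cast
      ring
    have hint : ∀ f g : ℝ → ℝ, MemLp f 2 (volume : Measure ℝ) → MemLp g 2 (volume : Measure ℝ) →
        Integrable (fun x => f x * (-g x + scaledPotential ν x * f x)) volume := fun f g hf hg => by
      have h1 := hf.integrable_mul hg
      have h2 := hf.integrable_sq.bdd_mul (continuous_scaledPotential ν).aestronglyMeasurable
        (Eventually.of_forall (abs_scaledPotential_le hν))
      refine (h2.sub h1).congr (Eventually.of_forall fun x => ?_)
      simp only [Pi.sub_apply, Pi.mul_apply]
      ring
    rw [re_inner_eq_integral a _ haE hae, ← integral_add (hint _ _ (hLre k) (hLre k₂))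
      (hint _ _ (hLim k) (hLim k₂)), ← integral_const_mul]
    refine integral_congr_ae (Eventually.of_forall fun x => ?_)
    simp
    ring
  change 0 ≤ (inner ℂ a (-(mass ν : ℂ) • b + mulCLM hr.potential_memLp a)).re +
        12 * √ν * mass ν * ‖a‖ ^ 2 - mass ν * Metric.infDist a (modeSpan hν.1) ^ 2
  rw [hinner, hnorm]
  nlinarith [mul_le_mul_of_nonneg_left hdist hm.le, mul_le_mul_of_nonneg_left h₁ hm.le,
    mul_le_mul_of_nonneg_left h₂ hm.le]

theorem norm_le_infDist_of_orthogonal (hν : 0 < ν) {u : L2} (h0 : inner ℂ (oddVec hν) u = 0)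
    (h1 : inner ℂ (evenVec hν) u = 0) : ‖u‖ ≤ Metric.infDist u (modeSpan hν) := by
  refine (Metric.le_infDist ⟨0, (modeSpan hν).zero_mem⟩).mpr fun y hy => ?_
  have hyu : inner ℂ y u = 0 := by
    obtain ⟨a, b, rfl⟩ := Submodule.mem_span_pair.mp hy
    simp [inner_add_left, inner_smul_left, h0, h1]
  have huy : inner ℂ u y = 0 := by rw [← inner_conj_symm, hyu, map_zero]
  have h2 : ‖u - y‖ ^ 2 = ‖u‖ ^ 2 + ‖y‖ ^ 2 := by
    rw [norm_sub_sq (𝕜 := ℂ), huy]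
    simp
  rw [dist_eq_norm]
  exact le_of_sq_le_sq (by nlinarith [sq_nonneg ‖y‖]) (norm_nonneg _)

theorem oddVec_ne_zero (hν : 0 < ν) : oddVec hν ≠ 0 := by
  intro h
  have h1 : (fun x => (oddMode ν x : ℂ)) =ᵐ[volume] fun _ => 0 := by
    filter_upwards [oddVec_ae hν, Lp.coeFn_zero ℂ 2 (volume : Measure ℝ)] with x e1 e2
    rw [← e1, h, e2]
    rfl
  have h2 := Continuous.ae_eq_iff_eq volume
    (Complex.continuous_ofReal.comp (continuous_oddMode ν)) continuous_const |>.mp h1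
  have h3 := congrFun h2 1
  have h4 := oddMode_pos ν one_pos
  simp at h3
  exact h4.ne' h3

theorem exists_linearized_oddVec (hν : ν ∈ Ioo (0 : ℝ) 1) {r : ℝ → ℝ} (hr : IsPulse ν r) :
    ∃ h : oddVec hν.1 ∈ (linearized hr).domain, linearized hr ⟨oddVec hν.1, h⟩ = 0 := by
  have hc : 0 < √ν := Real.sqrt_pos.mpr hν.1
  have hL'' : MemLp (fun x => ((scaledPotential ν x * oddMode ν x : ℝ) : ℂ)) 2
      (volume : Measure ℝ) := by
    refine MemLp.ofReal ?_
    refine memLp_two_of_abs_le hν.1 (M := 28 * (√ν)⁻¹)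
      ((continuous_scaledPotential ν).mul (continuous_oddMode ν)) fun x => ?_
    change |scaledPotential ν x * oddMode ν x| ≤ _
    rw [abs_mul, mul_div_assoc]
    exact mul_le_mul (abs_scaledPotential_le hν x) (abs_oddMode_le hν.1 x) (abs_nonneg _)
      (by norm_num)
  have hb : ∀ x, |oddMode ν x| ≤ (√ν)⁻¹ := fun x =>
    (abs_oddMode_le_evenMode ν x).trans (evenMode_le hν.1 x)
  have hci : 0 < (√ν)⁻¹ := inv_pos.mpr hc
  obtain ⟨hmem, hd⟩ := exists_mem_H2_of_hasDerivAt (M := 28 * (√ν)⁻¹) (hasDerivAt_oddMode ν)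
    (hasDerivAt_oddModeDeriv hν.1.le) ((continuous_scaledPotential ν).mul (continuous_oddMode ν))
    (fun x => (hb x).trans (by linarith)) (fun x => (abs_oddModeDeriv_le hν.1 x).trans (by linarith))
    (fun x => by
      rw [abs_mul]
      exact mul_le_mul (abs_scaledPotential_le hν x) (hb x) (abs_nonneg _) (by norm_num))
    (memLp_oddMode hν.1).ofReal hL''
  refine ⟨hmem, ?_⟩
  change -(mass ν : ℂ) • secondDeriv ⟨oddVec hν.1, hmem⟩ +
    mulOp hr.potential_memLp (oddVec hν.1) = 0
  rw [show secondDeriv ⟨oddVec hν.1, hmem⟩ = _ from hd]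
  refine Lp.ext ?_
  filter_upwards [Lp.coeFn_add (-(mass ν : ℂ) • hL''.toLp _)
      (mulOp hr.potential_memLp (oddVec hν.1)), Lp.coeFn_smul (-(mass ν : ℂ)) (hL''.toLp _),
    mulOp_ae hr.potential_memLp (oddVec hν.1), oddVec_ae hν.1, hL''.coeFn_toLp,
    Lp.coeFn_zero ℂ 2 (volume : Measure ℝ)] with x e1 e2 e3 e4 e5 e6
  rw [e1, Pi.add_apply, e2, Pi.smul_apply, e3, e4, e5, hr.potential_eq hν, e6]
  simp
  ring

/-- The even mode solves the equation with the excess added to the potential, so `A` acts on it as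
multiplication by `-m` times the excess. -/
theorem exists_linearized_evenVec_neg (hν : ν ∈ Ioo (0 : ℝ) 1) {r : ℝ → ℝ} (hr : IsPulse ν r) :
    ∃ h : evenVec hν.1 ∈ (linearized hr).domain,
      (inner ℂ (evenVec hν.1) (linearized hr ⟨evenVec hν.1, h⟩)).re < 0 := by
  have hc : 0 < √ν := Real.sqrt_pos.mpr hν.1
  have hm : 0 < mass ν := by unfold mass; linarith [hν.2]
  have hQc : Continuous fun x => scaledPotential ν x + excess ν x :=
    (continuous_scaledPotential ν).add (continuous_excess ν)
  have hQb : ∀ x, |scaledPotential ν x + excess ν x| ≤ 28 + 12 * √ν := fun x => by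
    refine (abs_add_le _ _).trans (add_le_add (abs_scaledPotential_le hν x) ?_)
    rw [abs_of_pos (excess_pos hν.1 x)]
    exact excess_le ν x
  have hL'' : MemLp (fun x => (((scaledPotential ν x + excess ν x) * evenMode ν x : ℝ) : ℂ)) 2
      (volume : Measure ℝ) := by
    refine MemLp.ofReal ?_
    refine memLp_two_of_abs_le hν.1 (M := (28 + 12 * √ν) * (√ν)⁻¹)
      (hQc.mul (continuous_evenMode ν)) fun x => ?_
    change |(scaledPotential ν x + excess ν x) * evenMode ν x| ≤ _
    rw [abs_mul, mul_div_assoc]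
    exact mul_le_mul (hQb x) (abs_evenMode_le hν.1 x) (abs_nonneg _) (by positivity)
  have hb : ∀ x, |evenMode ν x| ≤ (√ν)⁻¹ := fun x => by
    rw [abs_of_pos (evenMode_pos ν x)]
    exact evenMode_le hν.1 x
  have hci : 0 < (√ν)⁻¹ := inv_pos.mpr hc
  obtain ⟨hmem, hd⟩ := exists_mem_H2_of_hasDerivAt (M := (28 + 12 * √ν) * (√ν)⁻¹)
    (hasDerivAt_evenMode ν) (hasDerivAt_evenModeDeriv hν.1.le) (hQc.mul (continuous_evenMode ν))
    (fun x => (hb x).trans (by nlinarith)) (fun x => (abs_evenModeDeriv_le hν.1 x).trans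
      (by nlinarith))
    (fun x => by
      rw [abs_mul]
      exact mul_le_mul (hQb x) (hb x) (abs_nonneg _) (by positivity))
    (memLp_evenMode hν.1).ofReal hL''
  refine ⟨hmem, ?_⟩
  have hA : linearized hr ⟨evenVec hν.1, hmem⟩ = -(mass ν : ℂ) • hL''.toLp _ +
      mulOp hr.potential_memLp (evenVec hν.1) := by
    rw [← hd]
    rfl
  have hae : (linearized hr ⟨evenVec hν.1, hmem⟩ : L2) =ᵐ[volume] fun x =>
      ((-(mass ν * (excess ν x * evenMode ν x)) : ℝ) : ℂ) := by
    rw [hA]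
    filter_upwards [Lp.coeFn_add (-(mass ν : ℂ) • hL''.toLp _)
        (mulOp hr.potential_memLp (evenVec hν.1)), Lp.coeFn_smul (-(mass ν : ℂ)) (hL''.toLp _),
      mulOp_ae hr.potential_memLp (evenVec hν.1), evenVec_ae hν.1, hL''.coeFn_toLp]
      with x e1 e2 e3 e4 e5
    rw [e1, Pi.add_apply, e2, Pi.smul_apply, e3, e4, e5, hr.potential_eq hν, smul_eq_mul]
    push_cast
    ring
  rw [re_inner_eq_integral _ _ (evenVec_ae hν.1) hae]
  have hf : ∀ x, (evenMode ν x : ℂ).re * ((-(mass ν * (excess ν x * evenMode ν x)) : ℝ) : ℂ).re +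
      (evenMode ν x : ℂ).im * ((-(mass ν * (excess ν x * evenMode ν x)) : ℝ) : ℂ).im =
      -(mass ν * (excess ν x * evenMode ν x ^ 2)) := fun x => by
    simp only [Complex.ofReal_re, Complex.ofReal_im]
    ring
  simp only [hf]
  rw [integral_neg, integral_const_mul, neg_lt_zero]
  refine mul_pos hm ?_
  have hi : Integrable (fun x => excess ν x * evenMode ν x ^ 2) volume :=
    (memLp_evenMode hν.1).integrable_sq.bdd_mul (c := 12 * √ν)
      (continuous_excess ν).aestronglyMeasurable (Eventually.of_forall fun x => by
        rw [Real.norm_of_nonneg (excess_pos hν.1 x).le]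
        exact excess_le ν x)
  have hpos : ∀ x, 0 < excess ν x * evenMode ν x ^ 2 := fun x =>
    mul_pos (excess_pos hν.1 x) (pow_pos (evenMode_pos ν x) 2)
  rw [integral_pos_iff_support_of_nonneg (fun x => (hpos x).le) hi]
  have : Function.support (fun x => excess ν x * evenMode ν x ^ 2) = univ :=
    eq_univ_of_forall fun x => (hpos x).ne'
  rw [this]
  simp

/-- The spectrum of the linearized operator for all `ν` with `12 √ν < 1`. -/
theorem spectrum_linearized (hν : ν ∈ Ioo (0 : ℝ) 1) (hν' : 12 * √ν < 1) {r : ℝ → ℝ}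
    (hr : IsPulse ν r) :
    ∃ lam : ℝ, lam < 0 ∧ -(12 * √ν * mass ν) ≤ lam ∧ (lam : ℂ) ∈ spectrum (linearized hr) ∧
      (0 : ℂ) ∈ spectrum (linearized hr) ∧
      (∀ z ∈ spectrum (linearized hr), ∃ x : ℝ, z = x ∧
        (x = lam ∨ x = 0 ∨ (1 - 12 * √ν) * mass ν ≤ x)) ∧
      Module.finrank ℂ (eigenspace (linearized hr) (lam : ℂ)) = 1 ∧
      Module.finrank ℂ (eigenspace (linearized hr) 0) = 1 := by
  have hm : 0 < mass ν := by unfold mass; linarith [hν.2]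
  obtain ⟨h0, hA0⟩ := exists_linearized_oddVec hν hr
  obtain ⟨h1, hneg⟩ := exists_linearized_evenVec_neg hν hr
  -- Dropping the distance gives the global lower bound; orthogonality to both modes makes the
  -- distance equal to the norm and gives the gap `κ = (1 - 12 √ν) m`.
  refine (isPerturbedInverse_linearized hr hm.ne').spectrum_of_form_bounds
    (mul_pos (by linarith) hm) (fun u => ?_) (e₀ := ⟨_, h0⟩) (oddVec_ne_zero hν.1) hA0
    (evenVec hν.1) (fun u hu0 hu1 => ?_) (w := ⟨_, h1⟩) hneg
  · have h := form_ge_infDist_sq hν hr u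
    have h2 : 0 ≤ mass ν * Metric.infDist (u : L2) (modeSpan hν.1) ^ 2 := by positivity
    linarith
  · have h := form_ge_infDist_sq hν hr u
    have h2 : ‖(u : L2)‖ ^ 2 ≤ Metric.infDist (u : L2) (modeSpan hν.1) ^ 2 :=
      pow_le_pow_left₀ (norm_nonneg _) (norm_le_infDist_of_orthogonal hν.1 hu0 hu1) 2
    have h3 := mul_le_mul_of_nonneg_left h2 hm.le
    linarith

end Form

end

end PulseLinearization

theorem theorem2p7 :
    ∃ K : ℝ, 0 < K ∧ ∃ ν₀ ∈ Set.Ioo (0 : ℝ) 1,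
      ∀ ν ∈ Set.Ioo (0 : ℝ) ν₀, ∀ (r : ℝ → ℝ) (hr : PulseLinearization.IsPulse ν r),
        PulseLinearization.spectrum (PulseLinearization.linearized hr) ⊆
            Complex.ofReal '' (Set.Icc (-K) K ∪ Set.Ici (2 * K)) ∧
        ∃ lam : ℝ, lam < 0 ∧
          IsLeast {x : ℝ | (x : ℂ) ∈
            PulseLinearization.spectrum (PulseLinearization.linearized hr)} lam ∧
          PulseLinearization.spectrum (PulseLinearization.linearized hr) ∩
              Complex.ofReal '' Set.Icc (-K) K = {(lam : ℂ), 0} ∧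
          Module.finrank ℂ
            (PulseLinearization.eigenspace (PulseLinearization.linearized hr) (lam : ℂ)) = 1 ∧
          Module.finrank ℂ
            (PulseLinearization.eigenspace (PulseLinearization.linearized hr) 0) = 1 := by
  -- `K` is a quarter of the limiting mass `3/16`. With `√ν ≤ 1/50` one has `12 √ν ≤ 0.24 < 1/4`, so
  -- `lam ≥ -K`, while `(1 - 12 √ν) m` is at least `0.76 · (1 - 1/2500) · 3/16`, above `2K = (1/2) ·
  -- 3/16`.
  refine ⟨3 / 64, by norm_num, 1 / 2500, by norm_num, fun ν hν r hr => ?_⟩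
  have hν1 : ν ∈ Set.Ioo (0 : ℝ) 1 := ⟨hν.1, hν.2.trans (by norm_num)⟩
  have hs : √ν ≤ 1 / 50 := by
    rw [Real.sqrt_le_left (by norm_num)]
    linarith [hν.2]
  have hs0 := Real.sqrt_nonneg ν
  have hm : PulseLinearization.mass ν ≤ 3 / 16 := by
    unfold PulseLinearization.mass
    linarith [hν.1]
  have hm' : 3 / 16 * (1 - 1 / 2500) ≤ PulseLinearization.mass ν := by
    unfold PulseLinearization.mass
    linarith [hν.2]
  obtain ⟨lam, hlam, hlam', hlams, h0s, hsp, hf1, hf2⟩ :=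
    PulseLinearization.spectrum_linearized hν1 (by linarith) hr
  have hlamK : -(3 / 64) ≤ lam := by nlinarith
  have hgap : 2 * (3 / 64) ≤ (1 - 12 * √ν) * PulseLinearization.mass ν := by nlinarith
  refine ⟨fun z hz => ?_, lam, hlam, ⟨hlams, fun x hx => ?_⟩, ?_, hf1, hf2⟩
  · obtain ⟨x, rfl, rfl | rfl | hx⟩ := hsp z hz
    · exact ⟨x, Or.inl ⟨hlamK, by linarith⟩, rfl⟩
    · exact ⟨0, Or.inl (by norm_num), rfl⟩
    · exact ⟨x, Or.inr (hgap.trans hx), rfl⟩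
  · obtain ⟨y, hy, h⟩ := hsp x hx
    obtain rfl : x = y := by exact_mod_cast hy
    rcases h with rfl | rfl | h
    · exact le_rfl
    · exact hlam.le
    · linarith
  · ext z
    constructor
    · rintro ⟨hz, y, hy, rfl⟩
      obtain ⟨x, hx, h⟩ := hsp _ hz
      obtain rfl : y = x := by exact_mod_cast hx
      rcases h with rfl | rfl | h
      · exact Or.inl rfl
      · exact Or.inr (by simp)
      · linarith [hy.2]
    · rintro (rfl | rfl)
      · exact ⟨hlams, lam, ⟨hlamK, by linarith⟩, rfl⟩
      · exact ⟨h0s, 0, by norm_num, by simp⟩
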